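/- Let $M$ be a smooth ($C^\infty$, finite-dimensional, Hausdorff, $\sigma$-compact) manifold, and let $T^{big}M=TM\oplus T^*M$ carry the neutral metric $g((X,\alpha),(Y,\beta))=\frac12(\alpha(Y)+\beta(X))$ and the Courant bracket $$[(X,\alpha),(Y,\beta)]=\bigl([X,Y],\,L_X\beta-L_Y\alpha+\tfrac12 d(\alpha(Y)-\beta(X))\bigr),$$ extended complex bilinearly to complex sections. A *generalized F-structure* is a smooth $g$-skew-symmetric endomorphism $\Phi$ of $T^{big}M$ with $\Phi^3+\Phi=0$; let $E$ be its $\sqrt{-1}$-eigenbundle in $T^{big}M\otimes\mathbb C$ and $S=\ker\Phi$ (complexified). It is a *generalized CRF-structure* if $[E,E]\subseteq E$. A *generalized Riemannian metric* is a smooth positive definite metric $G$ on $T^{big}M$ such that the endomorphism $\sharp_G$ given by $2g(\sharp_G u,v)=G(u,v)$ satisfies $\sharp_G^2=\mathrm{Id}$ and is a $g$-isometry. Writing $\sharp_G(X,0)=(\varphi X,\cdot)$ and $\sharp_G(0,\alpha)=(\sharp_\gamma\alpha,\cdot)$, it determines a Riemannian metric $\gamma$ with $\flat_\gamma=\sharp_\gamma^{-1}$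 and a $2$-form $\psi$ with $\flat_\psi=-\flat_\gamma\circ\varphi$; the $(\pm1)$-eigenbundles of $\sharp_G$ are $V_\pm=\{(X,i(X)(\psi\pm\gamma))\}$, and $\tau_\pm:V_\pm\to TM$ denotes the projection. $(\Phi,G)$ is a *generalized metric CRF-structure* if $\Phi$ is a generalized CRF-structure that is $G$-skew-symmetric. Then $\Phi$ preserves $V_\pm$ and we put $F_\pm=\tau_\pm\circ\Phi|_{V_\pm}\circ\tau_\pm^{-1}\in\mathrm{End}(TM)$. With $E_\pm=V_\pm\cap E$ and $S_\pm=V_\pm\cap S$ (complexified), $(\Phi,G)$ is a *CRFK-structure* if $$[E_\pm,E_\pm]\subseteq E_\pm,\qquad [E_\pm,S_\pm]\subseteq E_\pm\oplus S_\pm .$$ A *classical metric CRF-structure* is a pair $(F,\gamma)$ of a smooth $F\in\mathrm{End}(TM)$ with $F^3+F=0$ and a Riemannian metric $\gamma$ with $\gamma(X,FY)+\gamma(FX,Y)=0$, such that the eigenbundles $H,Q_c\subseteq TM\otimes\mathbb C$ of $F$ for the eigenvalues $\sqrt{-1},0$ satisfy $[H,H]\subseteq H$ and $[H,Q_c]\subseteq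 H\oplus Q_c$ (Lie brackets). **Proposition.** Let $(\Phi,G)$ be a generalized metric CRF-structure on $M$ with associated data $(F_\pm,\gamma,\psi)$, and let $\nabla$ be the Levi-Civita connection of $\gamma$. Then $(\Phi,G)$ is a CRFK-structure if and only if both $(F_+,\gamma)$ and $(F_-,\gamma)$ are classical metric CRF-structures and, for both signs and all vector fields $X,Y,Z$ on $M$, $$\gamma\bigl(F_\pm X,(\nabla_ZF_\pm)(Y)\bigr)=\pm\tfrac12\bigl[d\psi(F_\pm^2X,Y,Z)+d\psi(F_\pm X,F_\pm Y,Z)\bigr].$$ Here $d\psi(X,Y,Z)=X\psi(Y,Z)+Y\psi(Z,X)+Z\psi(X,Y)-\psi([X,Y],Z)-\psi([Y,Z],X)-\psi([Z,X],Y)$. -/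

import Mathlib

open Bundle Manifold VectorField
open scoped ContDiff TensorProduct

noncomputable section

namespace GenCRF

/-! ### Linear algebra on `V ⊕ V*` -/

section Fibre

variable {V : Type*} [AddCommGroup V] [Module ℝ V] [TopologicalSpace V]
  [IsTopologicalAddGroup V] [ContinuousSMul ℝ V]

/-- The neutral metric `g((X, α), (Y, β)) = (α(Y) + β(X)) / 2` on `V ⊕ V*`. -/
def neutral : LinearMap.BilinForm ℝ (V × (V →L[ℝ] ℝ)) :=
  LinearMap.mk₂ ℝ (fun u v => (1 / 2 : ℝ) * (u.2 v.1 + v.2 u.1))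
    (by intro a b c; simp; ring) (by intro r a b; simp; ring)
    (by intro a b c; simp; ring) (by intro r a b; simp; ring)

set_option linter.unusedSectionVars false

theorem neutral_apply (u v : V × (V →L[ℝ] ℝ)) :
    neutral u v = (1 / 2 : ℝ) * (u.2 v.1 + v.2 u.1) := rfl

variable [T2Space V] [FiniteDimensional ℝ V]

theorem eq_zero_of_forall_dual {X : V} (h : ∀ β : V →L[ℝ] ℝ, β X = 0) : X = 0 :=
  (Module.forall_dual_apply_eq_zero_iff ℝ X).1 fun f => h (LinearMap.toContinuousLinearMap f)

theorem neutral_nondegenerate : (neutral (V := V)).Nondegenerate := by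
  have key : ∀ u : V × (V →L[ℝ] ℝ), (∀ v, neutral u v = 0) → u = 0 := by
    intro u h
    refine Prod.ext (eq_zero_of_forall_dual fun β => ?_) (ContinuousLinearMap.ext fun Y => ?_)
    · simpa [neutral_apply] using h (0, β)
    · simpa [neutral_apply] using h (Y, 0)
  refine ⟨key, fun u h => key u fun v => ?_⟩
  have := h v
  rw [neutral_apply] at this ⊢
  linarith

instance instFiniteDimensionalDual : FiniteDimensional ℝ (V →L[ℝ] ℝ) :=
  LinearEquiv.finiteDimensional
    (LinearMap.toContinuousLinearMap : (V →ₗ[ℝ] ℝ) ≃ₗ[ℝ] (V →L[ℝ] ℝ))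

/-- The musical endomorphism `♯_G` of `V ⊕ V*`, determined by `2 g(♯_G u, v) = G(u, v)`. -/
def sharpOf (G : LinearMap.BilinForm ℝ (V × (V →L[ℝ] ℝ))) :
    Module.End ℝ (V × (V →L[ℝ] ℝ)) :=
  (1 / 2 : ℝ) • ((neutral.toDual neutral_nondegenerate).symm.toLinearMap ∘ₗ G)

theorem two_neutral_sharpOf (G : LinearMap.BilinForm ℝ (V × (V →L[ℝ] ℝ)))
    (u v : V × (V →L[ℝ] ℝ)) : 2 * neutral (sharpOf G u) v = G u v := by
  simp [sharpOf]

variable (V) in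
/-- A generalized Euclidean metric on `V`: a positive definite metric `G` on `V ⊕ V*` such that
`♯_G² = Id` and `♯_G` is a `g`-isometry. -/
structure GenEuclideanMetric where
  form : LinearMap.BilinForm ℝ (V × (V →L[ℝ] ℝ))
  symm : ∀ u v, form u v = form v u
  pos : ∀ u, u ≠ 0 → 0 < form u u
  sharp_sharp : ∀ u, sharpOf form (sharpOf form u) = u
  neutral_sharp : ∀ u v, neutral (sharpOf form u) (sharpOf form v) = neutral u v

namespace GenEuclideanMetric

variable (G : GenEuclideanMetric V)

/-- The endomorphism `♯_G`. -/
def sharp : Module.End ℝ (V × (V →L[ℝ] ℝ)) := sharpOf G.form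

/-- The entry `φ : V → V` of the matrix of `♯_G`. -/
def phi : V →ₗ[ℝ] V := LinearMap.fst ℝ V (V →L[ℝ] ℝ) ∘ₗ G.sharp ∘ₗ LinearMap.inl ℝ V (V →L[ℝ] ℝ)

/-- The entry `♯_γ : V* → V` of the matrix of `♯_G`. -/
def sharpGamma : (V →L[ℝ] ℝ) →ₗ[ℝ] V :=
  LinearMap.fst ℝ V (V →L[ℝ] ℝ) ∘ₗ G.sharp ∘ₗ LinearMap.inr ℝ V (V →L[ℝ] ℝ)

theorem sharpGamma_injective : Function.Injective G.sharpGamma := by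
  rw [injective_iff_map_eq_zero]
  intro α hα
  by_contra hne
  have h1 := G.pos (0, α) (by simpa using hne)
  rw [← two_neutral_sharpOf, neutral_apply] at h1
  have h2 : (sharpOf G.form ((0 : V), α)).1 = 0 := hα
  simp [h2] at h1

/-- The isomorphism `♭_γ : V → V*` inverse to `♯_γ`. -/
def flatGamma : V ≃ₗ[ℝ] (V →L[ℝ] ℝ) :=
  (LinearEquiv.ofInjectiveOfFinrankEq G.sharpGamma G.sharpGamma_injective
    (((LinearMap.toContinuousLinearMap : (V →ₗ[ℝ] ℝ) ≃ₗ[ℝ] (V →L[ℝ] ℝ)).finrank_eq.symm).trans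
      Subspace.dual_finrank_eq)).symm

/-- The metric `γ(X, Y) = (♭_γ X)(Y)` induced by `G` on `V`. -/
def gamma : LinearMap.BilinForm ℝ V :=
  ContinuousLinearMap.coeLM ℝ ∘ₗ G.flatGamma.toLinearMap

/-- The `2`-form induced by `G` on `V`: `♭_ψ = - ♭_γ ∘ φ`. -/
def psi : LinearMap.BilinForm ℝ V := - (G.gamma ∘ₗ G.phi)

/-- For `ε = ± 1`, the map `X ↦ (X, i(X)(ψ + ε γ))`. It is the inverse of the projection to `V` of
the `ε`-eigenspace of `♯_G`. -/
def tauInv (ε : ℝ) : V →ₗ[ℝ] V × (V →L[ℝ] ℝ) :=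
  LinearMap.prod LinearMap.id
    (- (G.flatGamma.toLinearMap ∘ₗ G.phi) + ε • G.flatGamma.toLinearMap)

/-- The structures `F_± = τ_± ∘ Φ ∘ τ_±⁻¹` on `V`, for `ε = ± 1`. -/
def fPart (Φ : Module.End ℝ (V × (V →L[ℝ] ℝ))) (ε : ℝ) : Module.End ℝ V :=
  LinearMap.fst ℝ V (V →L[ℝ] ℝ) ∘ₗ Φ ∘ₗ G.tauInv ε

end GenEuclideanMetric

end Fibre

/-- The element `u + √-1 v` of the complexification of a real vector space. -/
def cplx {W : Type*} [AddCommGroup W] [Module ℝ W] (u v : W) : ℂ ⊗[ℝ] W :=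
  (1 : ℂ) ⊗ₜ[ℝ] u + Complex.I ⊗ₜ[ℝ] v

/-- The `c`-eigenspace of a real endomorphism in the complexified vector space. -/
def eigen {W : Type*} [AddCommGroup W] [Module ℝ W] (T : Module.End ℝ W) (c : ℂ) :
    Submodule ℂ (ℂ ⊗[ℝ] W) :=
  Module.End.eigenspace (T.baseChange ℂ) c

/-! ### Fields on a manifold -/

section Fields

variable (E : Type*) [NormedAddCommGroup E] [NormedSpace ℝ E]
  (M : Type*) [TopologicalSpace M] [ChartedSpace E M]

variable {M} in
/-- The cotangent space. -/
abbrev Cotangent (x : M) : Type _ := TangentSpace 𝓘(ℝ, E) x →L[ℝ] ℝ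

variable {M} in
/-- The fibre `T_xM ⊕ T_x^*M` of the big tangent bundle. -/
abbrev BigTangent (x : M) : Type _ := TangentSpace 𝓘(ℝ, E) x × Cotangent E x

instance instFiniteDimensionalTangent [FiniteDimensional ℝ E] (x : M) : FiniteDimensional ℝ (TangentSpace 𝓘(ℝ, E) x) :=
  inferInstanceAs (FiniteDimensional ℝ E)

instance instT2SpaceTangent (x : M) : T2Space (TangentSpace 𝓘(ℝ, E) x) := inferInstanceAs (T2Space E)

variable [IsManifold 𝓘(ℝ, E) ∞ M]

/-- Smooth vector fields. -/
abbrev VecField : Type _ := Cₛ^∞⟮𝓘(ℝ, E); E, (TangentSpace 𝓘(ℝ, E) : M → Type _)⟯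

/-- Smooth `1`-forms. -/
abbrev OneForm : Type _ := Cₛ^∞⟮𝓘(ℝ, E); E →L[ℝ] ℝ, (Cotangent E : M → Type _)⟯

/-- Smooth sections of the big tangent bundle. -/
abbrev BigSection : Type _ := VecField E M × OneForm E M

variable {E M}

/-- The value of a section of the big tangent bundle at a point. -/
def BigSection.val (s : BigSection E M) (x : M) : BigTangent E x := (s.1 x, s.2 x)

/-- The value at `x` of the function `X(β(Z)) - β([X, Z])`. -/
def lieDerivAux (X : VecField E M) (β : OneForm E M) (x : M)
    (Z : Π y : M, TangentSpace 𝓘(ℝ, E) y) : ℝ :=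
  mvfderiv 𝓘(ℝ, E) (fun y => β y (Z y)) x (X x) - β x (mlieBracket 𝓘(ℝ, E) X Z x)

variable [FiniteDimensional ℝ E]

theorem lieDerivAux_tensorial (X : VecField E M) (β : OneForm E M) (x : M) :
    TensorialAt 𝓘(ℝ, E) E (lieDerivAux X β x) x := by
  have : CompleteSpace E := FiniteDimensional.complete ℝ E
  have key : ∀ {Z : Π y : M, TangentSpace 𝓘(ℝ, E) y},
      MDifferentiableAt 𝓘(ℝ, E) (𝓘(ℝ, E).prod 𝓘(ℝ, E)) (fun y => TotalSpace.mk' E y (Z y)) x →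
      MDifferentiableAt 𝓘(ℝ, E) 𝓘(ℝ) (fun y => β y (Z y)) x := by
    intro Z hZ
    have hβ := (β.contMDiff.mdifferentiable (by simp)) x
    have h := MDifferentiableAt.clm_bundle_apply (E₂ := Bundle.Trivial M ℝ) hβ hZ
    rw [mdifferentiableAt_totalSpace] at h
    exact h.2
  refine ⟨fun {f Z} hf hZ => ?_, fun {Z Z'} hZ hZ' => ?_⟩
  · have h1 : (fun y => β y ((f • Z) y)) = fun y => f y * β y (Z y) := by
      funext y
      simp
    unfold lieDerivAux
    rw [h1, mvfderiv_fun_mul hf (key hZ), mlieBracket_smul_right hf hZ]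
    simp
    ring
  · have h1 : (fun y => β y ((Z + Z') y)) = fun y => β y (Z y) + β y (Z' y) := by
      funext y
      simp
    unfold lieDerivAux
    rw [h1, mvfderiv_fun_add (key hZ) (key hZ'), mlieBracket_add_right hZ hZ']
    simp
    ring

/-- The Lie derivative `L_X β` of a `1`-form:
`(L_X β)(Z) = X(β(Z)) - β([X, Z])` for all fields `Z`. -/
def lieDeriv (X : VecField E M) (β : OneForm E M) (x : M) : Cotangent E x :=
  TensorialAt.mkHom (lieDerivAux X β x) x (lieDerivAux_tensorial X β x)

/-- The Courant bracket
`[(X, α), (Y, β)] = ([X, Y], L_X β - L_Y α + d(α(Y) - β(X)) / 2)`. -/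
def courant (s t : BigSection E M) (x : M) : BigTangent E x :=
  (mlieBracket 𝓘(ℝ, E) s.1 t.1 x,
    lieDeriv s.1 t.2 x - lieDeriv t.1 s.2 x
      + (1 / 2 : ℝ) • mvfderiv 𝓘(ℝ, E) (fun y => s.2 y (t.1 y) - t.2 y (s.1 y)) x)

/-- `[A, B] ⊆ C` for fields of subspaces of the complexified big tangent spaces: the Courant
bracket, extended by complex bilinearity, of smooth complex sections of `A` and of `B` takes values
in `C`. Here `s₁ + √-1 s₂` and `t₁ + √-1 t₂` are the two complex sections. -/
def CourantClosed (A B C : ∀ x : M, Submodule ℂ (ℂ ⊗[ℝ] BigTangent E x)) : Prop :=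
  ∀ s₁ s₂ t₁ t₂ : BigSection E M,
    (∀ x, cplx (s₁.val x) (s₂.val x) ∈ A x) → (∀ x, cplx (t₁.val x) (t₂.val x) ∈ B x) →
    ∀ x, cplx (courant s₁ t₁ x - courant s₂ t₂ x) (courant s₁ t₂ x + courant s₂ t₁ x) ∈ C x

/-- `[A, B] ⊆ C` for fields of subspaces of the complexified tangent spaces, with the Lie bracket of
complex vector fields `X₁ + √-1 X₂` and `Y₁ + √-1 Y₂`. -/
def LieClosed (A B C : ∀ x : M, Submodule ℂ (ℂ ⊗[ℝ] TangentSpace 𝓘(ℝ, E) x)) : Prop :=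
  ∀ X₁ X₂ Y₁ Y₂ : VecField E M,
    (∀ x, cplx (X₁ x) (X₂ x) ∈ A x) → (∀ x, cplx (Y₁ x) (Y₂ x) ∈ B x) →
    ∀ x, cplx (mlieBracket 𝓘(ℝ, E) X₁ Y₁ x - mlieBracket 𝓘(ℝ, E) X₂ Y₂ x)
      (mlieBracket 𝓘(ℝ, E) X₁ Y₂ x + mlieBracket 𝓘(ℝ, E) X₂ Y₁ x) ∈ C x

end Fields

/-! ### Generalized F-structures and generalized Riemannian metrics -/

section Structures

variable (E : Type*) [NormedAddCommGroup E] [NormedSpace ℝ E] [FiniteDimensional ℝ E]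
  (M : Type*) [TopologicalSpace M] [ChartedSpace E M] [IsManifold 𝓘(ℝ, E) ∞ M]

/-- A generalized F-structure, as an endomorphism `Φ` of the big tangent bundle with `Φ³ + Φ = 0`
that is skew-symmetric with respect to the neutral metric. Smoothness of `Φ` means that it maps
smooth sections to smooth sections. -/
structure GenFStructure where
  toFun : ∀ x : M, Module.End ℝ (BigTangent E x)
  smooth : ∀ s : BigSection E M, ∃ t : BigSection E M, ∀ x, t.val x = toFun x (s.val x)
  cube : ∀ x u, toFun x (toFun x (toFun x u)) + toFun x u = 0
  skew : ∀ x u v, neutral (toFun x u) v + neutral u (toFun x v) = 0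

/-- A generalized Riemannian metric: a smooth field of generalized Euclidean metrics on the tangent
spaces. Smoothness means that `G(s, t)` is smooth for smooth sections `s` and `t`. -/
structure GenRiemannianMetric where
  toFun : ∀ x : M, GenEuclideanMetric (TangentSpace 𝓘(ℝ, E) x)
  smooth : ∀ s t : BigSection E M,
    ContMDiff 𝓘(ℝ, E) 𝓘(ℝ) ∞ (fun x => (toFun x).form (s.val x) (t.val x))

variable {E M}

namespace GenFStructure

variable (Φ : GenFStructure E M)

/-- The `√-1`-eigenbundle `E` of `Φ`. -/
def eigenE (x : M) : Submodule ℂ (ℂ ⊗[ℝ] BigTangent E x) := eigen (Φ.toFun x) Complex.I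

/-- The complexified kernel `S` of `Φ`. -/
def eigenS (x : M) : Submodule ℂ (ℂ ⊗[ℝ] BigTangent E x) := eigen (Φ.toFun x) 0

/-- `Φ` is a generalized CRF-structure if it is integrable, i.e., `[E, E] ⊆ E`. -/
def IsCRF : Prop := CourantClosed Φ.eigenE Φ.eigenE Φ.eigenE

end GenFStructure

namespace GenRiemannianMetric

variable (G : GenRiemannianMetric E M)

/-- The complexification of the `ε`-eigenbundle `V_±` of `♯_G`, for `ε = ± 1`. -/
def eigenV (ε : ℝ) (x : M) : Submodule ℂ (ℂ ⊗[ℝ] BigTangent E x) :=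
  eigen (G.toFun x).sharp (ε : ℂ)

/-- The Riemannian metric `γ` associated with `G`. -/
def gamma (x : M) : LinearMap.BilinForm ℝ (TangentSpace 𝓘(ℝ, E) x) := (G.toFun x).gamma

/-- The `2`-form `ψ` associated with `G`. -/
def psi (x : M) : LinearMap.BilinForm ℝ (TangentSpace 𝓘(ℝ, E) x) := (G.toFun x).psi

/-- The tensor fields `F_±` associated with `(Φ, G)`, for `ε = ± 1`. -/
def fPart (Φ : GenFStructure E M) (ε : ℝ) (x : M) : Module.End ℝ (TangentSpace 𝓘(ℝ, E) x) :=
  (G.toFun x).fPart (Φ.toFun x) ε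

end GenRiemannianMetric

/-- `(Φ, G)` is a generalized metric F-structure: `Φ` is skew-symmetric with respect to `G`. -/
def IsGenMetricF (Φ : GenFStructure E M) (G : GenRiemannianMetric E M) : Prop :=
  ∀ x u v, (G.toFun x).form (Φ.toFun x u) v + (G.toFun x).form u (Φ.toFun x v) = 0

/-- `(Φ, G)` is a generalized metric CRF-structure. -/
def IsGenMetricCRF (Φ : GenFStructure E M) (G : GenRiemannianMetric E M) : Prop :=
  IsGenMetricF Φ G ∧ Φ.IsCRF

/-- `(Φ, G)` is a generalized CRFK-structure: it is a generalized metric F-structure and, with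
`E_± = V_± ∩ E` and `S_± = V_± ∩ S`, one has `[E_±, E_±] ⊆ E_±` and
`[E_±, S_±] ⊆ E_± ⊕ S_±`. -/
def IsCRFK (Φ : GenFStructure E M) (G : GenRiemannianMetric E M) : Prop :=
  IsGenMetricF Φ G ∧ ∀ ε : ℝ, (ε = 1 ∨ ε = -1) →
    CourantClosed (fun x => G.eigenV ε x ⊓ Φ.eigenE x) (fun x => G.eigenV ε x ⊓ Φ.eigenE x)
      (fun x => G.eigenV ε x ⊓ Φ.eigenE x) ∧
    CourantClosed (fun x => G.eigenV ε x ⊓ Φ.eigenE x) (fun x => G.eigenV ε x ⊓ Φ.eigenS x)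
      (fun x => (G.eigenV ε x ⊓ Φ.eigenE x) ⊔ (G.eigenV ε x ⊓ Φ.eigenS x))

end Structures

/-! ### Classical structures -/

section Classical

variable {E : Type*} [NormedAddCommGroup E] [NormedSpace ℝ E]
  {M : Type*} [TopologicalSpace M] [ChartedSpace E M]

/-- The value at `x` of the exterior derivative of a `2`-form on three vector fields:
`dψ(X, Y, Z) = X ψ(Y, Z) + Y ψ(Z, X) + Z ψ(X, Y) - ψ([X, Y], Z) - ψ([Y, Z], X) - ψ([Z, X], Y)`. -/
def extDeriv₂ (ψ : ∀ x : M, LinearMap.BilinForm ℝ (TangentSpace 𝓘(ℝ, E) x))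
    (X Y Z : Π x : M, TangentSpace 𝓘(ℝ, E) x) (x : M) : ℝ :=
  mvfderiv 𝓘(ℝ, E) (fun y => ψ y (Y y) (Z y)) x (X x)
    + mvfderiv 𝓘(ℝ, E) (fun y => ψ y (Z y) (X y)) x (Y x)
    + mvfderiv 𝓘(ℝ, E) (fun y => ψ y (X y) (Y y)) x (Z x)
    - ψ x (mlieBracket 𝓘(ℝ, E) X Y x) (Z x)
    - ψ x (mlieBracket 𝓘(ℝ, E) Y Z x) (X x)
    - ψ x (mlieBracket 𝓘(ℝ, E) Z X x) (Y x)

variable [IsManifold 𝓘(ℝ, E) ∞ M]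

/-- A Riemannian metric; smoothness means that `γ(X, Y)` is smooth for smooth `X` and `Y`. -/
structure IsRiemannianMetric
    (γ : ∀ x : M, LinearMap.BilinForm ℝ (TangentSpace 𝓘(ℝ, E) x)) : Prop where
  symm : ∀ x u v, γ x u v = γ x v u
  pos : ∀ x u, u ≠ 0 → 0 < γ x u u
  smooth : ∀ X Y : VecField E M, ContMDiff 𝓘(ℝ, E) 𝓘(ℝ) ∞ (fun x => γ x (X x) (Y x))

/-- A classical F-structure: a smooth `(1, 1)`-tensor field with `F³ + F = 0`. Smoothness means that
`F` maps smooth vector fields to smooth vector fields. -/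
structure IsClassicalF (F : ∀ x : M, Module.End ℝ (TangentSpace 𝓘(ℝ, E) x)) : Prop where
  smooth : ∀ X : VecField E M, ∃ Y : VecField E M, ∀ x, Y x = F x (X x)
  cube : ∀ x u, F x (F x (F x u)) + F x u = 0

/-- A classical metric CRF-structure `(F, γ)`: a classical F-structure `F` and a Riemannian metric
`γ` such that `F` is `γ`-skew-symmetric and the eigenbundles `H`, `Q_c` of `F` with eigenvalues
`√-1`, `0` satisfy `[H, H] ⊆ H` and `[H, Q_c] ⊆ H ⊕ Q_c`. -/
structure IsClassicalMetricCRF (F : ∀ x : M, Module.End ℝ (TangentSpace 𝓘(ℝ, E) x))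
    (γ : ∀ x : M, LinearMap.BilinForm ℝ (TangentSpace 𝓘(ℝ, E) x)) : Prop where
  isClassicalF : IsClassicalF F
  isRiemannianMetric : IsRiemannianMetric γ
  skew : ∀ x u v, γ x u (F x v) + γ x (F x u) v = 0
  closed_H_H : LieClosed (fun x => eigen (F x) Complex.I) (fun x => eigen (F x) Complex.I)
    (fun x => eigen (F x) Complex.I)
  closed_H_Q : LieClosed (fun x => eigen (F x) Complex.I) (fun x => eigen (F x) 0)
    (fun x => eigen (F x) Complex.I ⊔ eigen (F x) 0)

/-- `∇` is the Levi-Civita connection of the metric `γ`: it is torsion-free and `∇γ = 0`.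
Here `cov Y x v` is `∇_v Y` at `x`. -/
structure IsLeviCivita (γ : ∀ x : M, LinearMap.BilinForm ℝ (TangentSpace 𝓘(ℝ, E) x))
    (cov : CovariantDerivative 𝓘(ℝ, E) E (TangentSpace 𝓘(ℝ, E) : M → Type _)) : Prop where
  torsion_free : ∀ (X Y : VecField E M) (x : M),
    cov Y x (X x) - cov X x (Y x) = mlieBracket 𝓘(ℝ, E) X Y x
  metric : ∀ (X Y : VecField E M) (x : M) (v : TangentSpace 𝓘(ℝ, E) x),
    mvfderiv 𝓘(ℝ, E) (fun y => γ y (X y) (Y y)) x v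
      = γ x (cov X x v) (Y x) + γ x (X x) (cov Y x v)

/-- The field `F X`. -/
def applyField (F : ∀ x : M, Module.End ℝ (TangentSpace 𝓘(ℝ, E) x))
    (X : Π x : M, TangentSpace 𝓘(ℝ, E) x) : Π x : M, TangentSpace 𝓘(ℝ, E) x :=
  fun x => F x (X x)

/-- The field `(∇_Z F)(Y) = ∇_Z (F Y) - F (∇_Z Y)`. -/
def covEnd (cov : CovariantDerivative 𝓘(ℝ, E) E (TangentSpace 𝓘(ℝ, E) : M → Type _))
    (F : ∀ x : M, Module.End ℝ (TangentSpace 𝓘(ℝ, E) x))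
    (Z Y : Π x : M, TangentSpace 𝓘(ℝ, E) x) : Π x : M, TangentSpace 𝓘(ℝ, E) x :=
  fun x => cov (applyField F Y) x (Z x) - F x (cov Y x (Z x))

end Classical

end GenCRF

end

noncomputable section

namespace GenCRF

/-! ### Smoothness criteria for sections -/

section SmoothCriteria

variable {E : Type*} [NormedAddCommGroup E] [NormedSpace ℝ E]
  {M : Type*} [TopologicalSpace M] [ChartedSpace E M]

/-! Each $V_\pm$ is a graph over $TM$, and $\tau_\pm$ carries $E_\pm$ and $S_\pm$ to the
eigenbundles $H$ and $Q_c$ of $F_\pm$. The vector part of a Courant bracket is a Lie bracket, so for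
sections of $V_\pm$ only the covector part can leave the graph. By torsion-freeness and
$\nabla\gamma=0$, this deviation, evaluated on $Z$, is (`courant_tauSec_snd_apply`)
$$T_Z(X,Y)=d\psi(X,Y,Z)\mp\bigl(\gamma(X,\nabla_ZY)-\gamma(Y,\nabla_ZX)\bigr).$$ Hence the CRFK
conditions split (`courantClosed_iff_lieClosed`) into the Lie conditions, which are what makes
$(F_\pm,\gamma)$ a classical metric CRF-structure, and the vanishing of $T_Z$ on $H\times H$ and
$H\times Q_c$.

Since $F^3=-F$, the fields $F^2X+\sqrt{-1}FX$ lie in $H$, and $Y=-F^2Y+(Y+F^2Y)$ splits off the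
kernel part of $Y$. So the vanishing of $T_Z$ is equivalent to $T_Z(FX,FY)+T_Z(F^2X,Y)=0$ for all
real $X,Y$ (`forall_add_eq_zero_iff_of_cube`). Differentiating $\gamma(FX,FY)+\gamma(F^2X,Y)=0$
along $Z$ turns this into the stated formula (`courantDefect_fField`). $T_Z$ is not tensorial in
$X,Y$; the comparison uses only its biadditivity on global fields, which is why $\Phi$, $\sharp_G$
and $F_\pm$ must first be seen to act on smooth sections. -/

/-- A family of continuous linear maps on a finite dimensional space is smooth if it is pointwise
smooth. -/
theorem contMDiffAt_clm_of_forall_apply {F G : Type*} [NormedAddCommGroup F] [NormedSpace ℝ F]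
    [FiniteDimensional ℝ F] [NormedAddCommGroup G] [NormedSpace ℝ G] {f : M → F →L[ℝ] G} {x : M}
    (h : ∀ v, ContMDiffAt 𝓘(ℝ, E) 𝓘(ℝ, G) ∞ (fun y => f y v) x) :
    ContMDiffAt 𝓘(ℝ, E) 𝓘(ℝ, F →L[ℝ] G) ∞ f x := by
  let b := Module.finBasis ℝ F
  have hf : f = fun y => ∑ i,
      ContinuousLinearMap.smulRightL ℝ F G (LinearMap.toContinuousLinearMap (b.coord i))
        (f y (b i)) := by
    funext y
    ext v
    conv_lhs => rw [← b.sum_repr v, map_sum]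
    simp
  rw [hf]
  refine contMDiffAt_finsetSum fun i _ => ?_
  exact (ContinuousLinearMap.contMDiff _).contMDiffAt.comp x (h (b i))

/-- A map to a finite dimensional space is smooth if it is weakly smooth. -/
theorem contMDiffAt_of_forall_dual {G : Type*} [NormedAddCommGroup G] [NormedSpace ℝ G]
    [FiniteDimensional ℝ G] {f : M → G} {x : M}
    (h : ∀ l : G →L[ℝ] ℝ, ContMDiffAt 𝓘(ℝ, E) 𝓘(ℝ) ∞ (fun y => l (f y)) x) :
    ContMDiffAt 𝓘(ℝ, E) 𝓘(ℝ, G) ∞ f x := by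
  let b := Module.finBasis ℝ G
  have hf : f = fun y => ∑ i, LinearMap.toContinuousLinearMap (b.coord i) (f y) • b i := by
    funext y
    conv_lhs => rw [← b.sum_repr (f y)]
    simp
  rw [hf]
  exact contMDiffAt_finsetSum fun i _ => (h _).smul contMDiffAt_const

/-- The function `β(X)` is smooth. -/
theorem contMDiff_oneForm_apply [IsManifold 𝓘(ℝ, E) ∞ M] (β : OneForm E M) (X : VecField E M) :
    ContMDiff 𝓘(ℝ, E) 𝓘(ℝ) ∞ (fun x => β x (X x)) := by
  intro x
  have h := ContMDiffAt.clm_bundle_apply (E₂ := Bundle.Trivial M ℝ) (β.contMDiff x)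
    (X.contMDiff x)
  rw [contMDiffAt_totalSpace] at h
  exact h.2

variable [FiniteDimensional ℝ E] [IsManifold 𝓘(ℝ, E) ∞ M] [T2Space M]

/-- Every local section that is constant in a trivialization is the germ of a smooth section. -/
theorem exists_section_eventuallyEq_symm (F : Type*) [NormedAddCommGroup F] [NormedSpace ℝ F]
    (V : M → Type*) [TopologicalSpace (TotalSpace F V)] [∀ x, AddCommGroup (V x)]
    [∀ x, Module ℝ (V x)] [∀ x, TopologicalSpace (V x)] [FiberBundle F V] [VectorBundle ℝ F V]
    [ContMDiffVectorBundle ∞ F V 𝓘(ℝ, E)] (x₀ : M) (w : F) :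
    ∃ s : Cₛ^∞⟮𝓘(ℝ, E); F, V⟯, ∀ᶠ x in nhds x₀, s x = (trivializationAt F V x₀).symm x w := by
  let t := trivializationAt F V x₀
  have hx₀ : x₀ ∈ t.baseSet := FiberBundle.mem_baseSet_trivializationAt' x₀
  have hU : t.baseSet ∈ nhds x₀ := t.open_baseSet.mem_nhds hx₀
  -- The closed support of the bump function lies in the trivializing set, so the cut-off section
  -- extends by zero; the function equals one near `x₀`, so the germ there is unchanged.
  obtain ⟨f, hf, -⟩ := (SmoothBumpFunction.nhds_basis_support (I := 𝓘(ℝ, E)) hU).mem_iff.1 hU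
  have hs : ContMDiffOn 𝓘(ℝ, E) (𝓘(ℝ, E).prod 𝓘(ℝ, F)) ∞
      (fun x => TotalSpace.mk' F x (t.symm x w)) t.baseSet := by
    intro x hx
    rw [t.contMDiffWithinAt_section _ hx]
    refine (contMDiffOn_const (c := w)).congr (fun y hy => ?_) x hx
    simp [t.apply_mk_symm hy]
  refine ⟨⟨(f : M → ℝ) • fun x => t.symm x w,
    ContMDiffOn.smul_section_of_tsupport f.contMDiff.contMDiffOn t.open_baseSet hf hs⟩, ?_⟩
  filter_upwards [f.eventuallyEq_one] with x hx
  simp [hx, t]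

/-- Every vector in a vector bundle is the value of a smooth section. -/
theorem exists_section_apply_eq (F : Type*) [NormedAddCommGroup F] [NormedSpace ℝ F]
    (V : M → Type*) [TopologicalSpace (TotalSpace F V)] [∀ x, AddCommGroup (V x)]
    [∀ x, Module ℝ (V x)] [∀ x, TopologicalSpace (V x)] [FiberBundle F V] [VectorBundle ℝ F V]
    [ContMDiffVectorBundle ∞ F V 𝓘(ℝ, E)] (x : M) (v : V x) :
    ∃ s : Cₛ^∞⟮𝓘(ℝ, E); F, V⟯, s x = v := by
  obtain ⟨s, hs⟩ := exists_section_eventuallyEq_symm (E := E) F V x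
    (trivializationAt F V x ⟨x, v⟩).2
  exact ⟨s, hs.self_of_nhds.trans
    (Trivialization.symm_apply_apply_mk _ (FiberBundle.mem_baseSet_trivializationAt' x) v)⟩

/-- Global fields with the germ of a coordinate frame let smoothness be tested on elements of
`VecField` alone; the next lemma does the same for coframes. -/
theorem exists_vecField_eventuallyEq (x₀ : M) (w : E) :
    ∃ Y : VecField E M, ∀ᶠ x in nhds x₀,
      Y x = (trivializationAt E (TangentSpace 𝓘(ℝ, E) : M → Type _) x₀).symmL ℝ x w := by
  obtain ⟨s, hs⟩ := exists_section_eventuallyEq_symm (E := E) E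
    (TangentSpace 𝓘(ℝ, E) : M → Type _) x₀ w
  refine ⟨s, ?_⟩
  have hU := (trivializationAt E (TangentSpace 𝓘(ℝ, E) : M → Type _) x₀).open_baseSet.mem_nhds
    (FiberBundle.mem_baseSet_trivializationAt' x₀)
  filter_upwards [hs, hU] with x hx hxU
  rw [hx, Trivialization.symmL_apply _ hxU]

theorem exists_oneForm_eventuallyEq (x₀ : M) (l : E →L[ℝ] ℝ) :
    ∃ β : OneForm E M, ∀ᶠ x in nhds x₀,
      β x = l.comp ((trivializationAt E
        (TangentSpace 𝓘(ℝ, E) : M → Type _) x₀).continuousLinearMapAt ℝ x) := by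
  obtain ⟨s, hs⟩ := exists_section_eventuallyEq_symm (E := E) (E →L[ℝ] ℝ)
    (Cotangent E : M → Type _) x₀ l
  refine ⟨s, ?_⟩
  have hU := (trivializationAt E (TangentSpace 𝓘(ℝ, E) : M → Type _) x₀).open_baseSet.mem_nhds
    (FiberBundle.mem_baseSet_trivializationAt' x₀)
  filter_upwards [hs, hU] with x hx hxU
  rw [hx]
  refine (Pretrivialization.continuousLinearMap_symm_apply' (RingHom.id ℝ)
    (e₁ := trivializationAt E (TangentSpace 𝓘(ℝ, E) : M → Type _) x₀)
    (e₂ := trivializationAt ℝ (Bundle.Trivial M ℝ) x₀) ⟨hxU, Set.mem_univ x⟩ l).trans ?_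
  ext v
  simp

/-- A `1`-form is smooth if its values on smooth vector fields are smooth. -/
theorem contMDiff_oneForm_of_forall_vecField {α : Π x : M, Cotangent E x}
    (h : ∀ Y : VecField E M, ContMDiff 𝓘(ℝ, E) 𝓘(ℝ) ∞ (fun x => α x (Y x))) :
    ContMDiff 𝓘(ℝ, E) (𝓘(ℝ, E).prod 𝓘(ℝ, E →L[ℝ] ℝ)) ∞
      (fun x => TotalSpace.mk' (E →L[ℝ] ℝ) x (α x)) := by
  intro x₀
  rw [contMDiffAt_section]
  refine contMDiffAt_clm_of_forall_apply fun v => ?_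
  obtain ⟨Y, hY⟩ := exists_vecField_eventuallyEq x₀ v
  refine (h Y).contMDiffAt.congr_of_eventuallyEq ?_
  filter_upwards [hY] with x hx
  rw [hx, hom_trivializationAt_apply]
  simp [ContinuousLinearMap.inCoordinates]

/-- A vector field is smooth if the values of smooth `1`-forms on it are smooth. -/
theorem contMDiff_vecField_of_forall_oneForm {X : Π x : M, TangentSpace 𝓘(ℝ, E) x}
    (h : ∀ β : OneForm E M, ContMDiff 𝓘(ℝ, E) 𝓘(ℝ) ∞ (fun x => β x (X x))) :
    ContMDiff 𝓘(ℝ, E) (𝓘(ℝ, E).prod 𝓘(ℝ, E)) ∞ (fun x => TotalSpace.mk' E x (X x)) := by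
  intro x₀
  rw [contMDiffAt_section]
  refine contMDiffAt_of_forall_dual fun l => ?_
  obtain ⟨β, hβ⟩ := exists_oneForm_eventuallyEq x₀ l
  refine (h β).contMDiffAt.congr_of_eventuallyEq ?_
  have hU := (trivializationAt E (TangentSpace 𝓘(ℝ, E) : M → Type _) x₀).open_baseSet.mem_nhds
    (FiberBundle.mem_baseSet_trivializationAt' x₀)
  filter_upwards [hβ, hU] with x hx hxU
  rw [hx]
  rw [ContinuousLinearMap.comp_apply, Trivialization.continuousLinearMapAt_apply,
    Trivialization.linearMapAt_apply, if_pos hxU]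

/-- If a field of isomorphisms `T_x^*M → T_xM` maps smooth `1`-forms to smooth vector fields, then
its inverse maps smooth vector fields to smooth `1`-forms. -/
theorem contMDiff_symm_vecField
    (A : ∀ x : M, TangentSpace 𝓘(ℝ, E) x ≃ₗ[ℝ] Cotangent E x)
    (hA : ∀ β : OneForm E M, ∃ X : VecField E M, ∀ x, X x = (A x).symm (β x)) (X : VecField E M) :
    ContMDiff 𝓘(ℝ, E) (𝓘(ℝ, E).prod 𝓘(ℝ, E →L[ℝ] ℝ)) ∞
      (fun x => TotalSpace.mk' (E →L[ℝ] ℝ) x (A x (X x))) := by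
  intro x₀
  let t := trivializationAt E (TangentSpace 𝓘(ℝ, E) : M → Type _) x₀
  have hU : t.baseSet ∈ nhds x₀ :=
    t.open_baseSet.mem_nhds (FiberBundle.mem_baseSet_trivializationAt' x₀)
  -- `S` is `(A x).symm` read in the trivialization at `x₀`. It is smooth by testing on coframes,
  -- and inversion of operators is smooth at invertible ones, so `A` is smooth in coordinates too.
  let S : M → (E →L[ℝ] ℝ) →L[ℝ] E := fun x => LinearMap.toContinuousLinearMap
    ((t.continuousLinearMapAt ℝ x).toLinearMap ∘ₗ (A x).symm.toLinearMap ∘ₗ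
      (ContinuousLinearMap.precomp ℝ (t.continuousLinearMapAt ℝ x)).toLinearMap)
  have hSapply : ∀ x l, S x l = t.continuousLinearMapAt ℝ x
      ((A x).symm (l.comp (t.continuousLinearMapAt ℝ x))) := fun x l => rfl
  have hS : ContMDiffAt 𝓘(ℝ, E) 𝓘(ℝ, (E →L[ℝ] ℝ) →L[ℝ] E) ∞ S x₀ := by
    refine contMDiffAt_clm_of_forall_apply fun l => ?_
    obtain ⟨β, hβ⟩ := exists_oneForm_eventuallyEq x₀ l
    obtain ⟨Y, hY⟩ := hA β
    have hYs := (contMDiffAt_section (n := ∞) x₀).1 (Y.contMDiff x₀)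
    refine hYs.congr_of_eventuallyEq ?_
    filter_upwards [hβ, hU] with x hx hxU
    rw [hSapply, hY, hx, Trivialization.continuousLinearMapAt_apply,
      Trivialization.linearMapAt_apply, if_pos hxU]
  have hequiv : ∀ x ∈ t.baseSet, (S x).IsInvertible := by
    intro x hx
    let e := t.continuousLinearEquivAt ℝ x hx
    refine ⟨(((e.arrowCongr (ContinuousLinearEquiv.refl ℝ ℝ)).toLinearEquiv.symm.trans
      (A x).symm).trans e.toLinearEquiv).toContinuousLinearEquiv, ?_⟩
    ext l
    rw [hSapply]
    have h1 : (t.continuousLinearMapAt ℝ x : TangentSpace 𝓘(ℝ, E) x →L[ℝ] E) =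
        (e : TangentSpace 𝓘(ℝ, E) x →L[ℝ] E) := by
      ext v
      simp [e, Trivialization.continuousLinearEquivAt_apply,
        Trivialization.coe_linearMapAt_of_mem _ hx]
    rw [h1]
    rfl
  have hinv : ContMDiffAt 𝓘(ℝ, E) 𝓘(ℝ, E →L[ℝ] (E →L[ℝ] ℝ)) ∞ (fun x => (S x).inverse) x₀ :=
    (ContinuousLinearMap.IsInvertible.contDiffAt_map_inverse
      (hequiv x₀ (mem_of_mem_nhds hU))).contMDiffAt.comp x₀ hS
  have hX := (contMDiffAt_section (n := ∞) x₀).1 (X.contMDiff x₀)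
  rw [contMDiffAt_section]
  refine (hinv.clm_apply hX).congr_of_eventuallyEq ?_
  filter_upwards [hU] with x hx
  have key : S x ((A x (X x)).comp (t.symmL ℝ x)) = (t ⟨x, X x⟩).2 := by
    have h1 : ((A x (X x)).comp (t.symmL ℝ x)).comp (t.continuousLinearMapAt ℝ x) = A x (X x) := by
      ext v
      rw [ContinuousLinearMap.comp_apply, ContinuousLinearMap.comp_apply,
        t.symmL_continuousLinearMapAt hx]
    rw [hSapply, h1, LinearEquiv.symm_apply_apply, Trivialization.continuousLinearMapAt_apply,
      Trivialization.linearMapAt_apply, if_pos hx]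
  obtain ⟨e, he⟩ := hequiv x hx
  rw [← key, ← he, ContinuousLinearMap.inverse_equiv, hom_trivializationAt_apply]
  ext v
  simp [ContinuousLinearMap.inCoordinates, t]

end SmoothCriteria

/-! ### Eigenspaces in complexifications -/

section Complexification

variable {W : Type*} [AddCommGroup W] [Module ℝ W]

/-- The two components are recovered by applying `re` and `im` to the factor `ℂ`. -/
theorem cplx_inj {u v u' v' : W} : cplx u v = cplx u' v' ↔ u = u' ∧ v = v' := by
  refine ⟨fun h => ⟨?_, ?_⟩, fun h => by rw [h.1, h.2]⟩
  · simpa [cplx] using congrArg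
      (fun w => TensorProduct.lid ℝ W (LinearMap.rTensor W Complex.reLm w)) h
  · simpa [cplx] using congrArg
      (fun w => TensorProduct.lid ℝ W (LinearMap.rTensor W Complex.imLm w)) h

theorem baseChange_cplx (T : Module.End ℝ W) (u v : W) :
    T.baseChange ℂ (cplx u v) = cplx (T u) (T v) := by
  simp [cplx]

theorem I_smul_cplx (u v : W) : Complex.I • cplx u v = cplx (-v) u := by
  simp [cplx, TensorProduct.smul_tmul', TensorProduct.neg_tmul, TensorProduct.tmul_neg, add_comm]

theorem ofReal_smul_cplx (r : ℝ) (u v : W) : (r : ℂ) • cplx u v = cplx (r • u) (r • v) := by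
  simp only [cplx, smul_add, TensorProduct.smul_tmul', ← TensorProduct.smul_tmul]
  simp [Complex.real_smul]

theorem cplx_add (u v u' v' : W) : cplx u v + cplx u' v' = cplx (u + u') (v + v') := by
  simp only [cplx, TensorProduct.tmul_add]
  abel

theorem cplx_mem_eigen_I (T : Module.End ℝ W) {u v : W} :
    cplx u v ∈ eigen T Complex.I ↔ T u = -v ∧ T v = u := by
  rw [eigen, Module.End.mem_eigenspace_iff, baseChange_cplx, I_smul_cplx, cplx_inj]

theorem cplx_mem_eigen_ofReal (T : Module.End ℝ W) (r : ℝ) {u v : W} :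
    cplx u v ∈ eigen T (r : ℂ) ↔ T u = r • u ∧ T v = r • v := by
  rw [eigen, Module.End.mem_eigenspace_iff, baseChange_cplx, ofReal_smul_cplx, cplx_inj]

theorem cplx_mem_eigen_zero (T : Module.End ℝ W) {u v : W} :
    cplx u v ∈ eigen T 0 ↔ T u = 0 ∧ T v = 0 := by
  simpa using cplx_mem_eigen_ofReal T 0 (u := u) (v := v)

/-- On the sum of the `√-1`- and `0`-eigenspaces one has `T² = √-1 T`. -/
theorem map_map_of_mem_sup_eigen (T : Module.End ℝ W) {u v : W}
    (h : cplx u v ∈ eigen T Complex.I ⊔ eigen T 0) : T (T u) = -T v ∧ T (T v) = T u := by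
  have key : ∀ w ∈ eigen T Complex.I ⊔ eigen T 0,
      T.baseChange ℂ (T.baseChange ℂ w) = Complex.I • T.baseChange ℂ w := by
    intro w hw
    obtain ⟨a, ha, b, hb, rfl⟩ := Submodule.mem_sup.1 hw
    rw [eigen, Module.End.mem_eigenspace_iff] at ha hb
    simp [ha, hb]
  have := key _ h
  rwa [baseChange_cplx, baseChange_cplx, I_smul_cplx, cplx_inj] at this

/-- The sum of the `√-1`- and `0`-eigenspaces of `T` inside an eigenspace of `J`, where
`T³ + T = 0` and `J` commutes with `T`. -/
theorem cplx_mem_inf_sup_inf_eigen (J T : Module.End ℝ W) (hJT : ∀ u, J (T u) = T (J u))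
    (hT : ∀ u, T (T (T u)) + T u = 0) (r : ℝ) {u v : W} :
    cplx u v ∈ (eigen J (r : ℂ) ⊓ eigen T Complex.I) ⊔ (eigen J (r : ℂ) ⊓ eigen T 0) ↔
      (J u = r • u ∧ J v = r • v) ∧ T (T u) = -T v ∧ T (T v) = T u := by
  constructor
  · intro h
    have h1 := (sup_le_sup inf_le_right inf_le_right : _ ≤ eigen T Complex.I ⊔ eigen T 0) h
    have h2 := (sup_le inf_le_left inf_le_left : _ ≤ eigen J (r : ℂ)) h
    exact ⟨(cplx_mem_eigen_ofReal J r).1 h2, map_map_of_mem_sup_eigen T h1⟩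
  · rintro ⟨⟨hu, hv⟩, h1, h2⟩
    -- For `T³ + T = 0`, the operators `-T²` and `1 + T²` are complementary projections onto the sum
    -- of the `±√-1`-eigenspaces and onto the kernel; the hypothesis `T² = √-1 T` excludes the
    -- eigenvalue `-√-1`.
    have hsplit : cplx u v = cplx (-T (T u)) (-T (T v)) + cplx (u + T (T u)) (v + T (T v)) := by
      rw [cplx_add]
      congr 1 <;> abel
    rw [hsplit]
    refine Submodule.add_mem_sup ⟨(cplx_mem_eigen_ofReal J r).2 ?_, (cplx_mem_eigen_I T).2 ?_⟩
      ⟨(cplx_mem_eigen_ofReal J r).2 ?_, (cplx_mem_eigen_zero T).2 ?_⟩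
    · simp [hJT, hu, hv]
    · have h3 := hT u
      rw [h1, map_neg] at h3
      have h4 := hT v
      rw [h2] at h4
      rw [map_neg, map_neg, h1, h2, map_neg, h2, h1]
      simp
    · simp [hJT, hu, hv]
    · simpa [add_comm] using And.intro (hT u) (hT v)

theorem cplx_mem_sup_eigen (T : Module.End ℝ W) (hT : ∀ u, T (T (T u)) + T u = 0) {u v : W} :
    cplx u v ∈ eigen T Complex.I ⊔ eigen T 0 ↔ T (T u) = -T v ∧ T (T v) = T u := by
  refine ⟨map_map_of_mem_sup_eigen T, fun h => ?_⟩
  -- With `J = id` and `r = 1` the condition on the eigenspace of `J` is empty.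
  have := (cplx_mem_inf_sup_inf_eigen (LinearMap.id : Module.End ℝ W) T (fun _ => rfl) hT 1).2
    ⟨⟨(one_smul ℝ u).symm, (one_smul ℝ v).symm⟩, h⟩
  exact (sup_le_sup inf_le_right inf_le_right : _ ≤ eigen T Complex.I ⊔ eigen T 0) this

end Complexification

/-! ### Generalized Euclidean metrics -/

section EuclideanFibre

set_option linter.unusedSectionVars false

variable {V : Type*} [AddCommGroup V] [Module ℝ V] [TopologicalSpace V]
  [IsTopologicalAddGroup V] [ContinuousSMul ℝ V] [T2Space V] [FiniteDimensional ℝ V]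

theorem neutral_comm (u v : V × (V →L[ℝ] ℝ)) : neutral u v = neutral v u := by
  simp only [neutral_apply]
  ring

theorem eq_of_forall_neutral_eq {u v : V × (V →L[ℝ] ℝ)} (h : ∀ w, neutral u w = neutral v w) :
    u = v :=
  sub_eq_zero.1 (neutral_nondegenerate.1 _ fun w => by simp [h w])

namespace GenEuclideanMetric

variable (G : GenEuclideanMetric V)

theorem two_neutral_sharp (u v : V × (V →L[ℝ] ℝ)) : 2 * neutral (G.sharp u) v = G.form u v :=
  two_neutral_sharpOf G.form u v

theorem sharp_involutive (u : V × (V →L[ℝ] ℝ)) : G.sharp (G.sharp u) = u := G.sharp_sharp u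

/-- Self-adjointness of `♯_G` expresses the symmetry of `G`. -/
theorem neutral_sharp_left (u v : V × (V →L[ℝ] ℝ)) :
    neutral (G.sharp u) v = neutral u (G.sharp v) := by
  have h1 := G.two_neutral_sharp u v
  have h2 := G.two_neutral_sharp v u
  rw [G.symm] at h1
  rw [neutral_comm u]
  linarith

@[simp]
theorem flatGamma_symm_apply (α : V →L[ℝ] ℝ) : G.flatGamma.symm α = G.sharpGamma α := rfl

@[simp]
theorem sharpGamma_flatGamma (X : V) : G.sharpGamma (G.flatGamma X) = X := by
  rw [← flatGamma_symm_apply, LinearEquiv.symm_apply_apply]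

theorem gamma_apply (X Y : V) : G.gamma X Y = G.flatGamma X Y := rfl

theorem sharp_fst (u : V × (V →L[ℝ] ℝ)) : (G.sharp u).1 = G.phi u.1 + G.sharpGamma u.2 := by
  conv_lhs => rw [show u = (u.1, 0) + (0, u.2) by simp, map_add]
  rfl

/-- Up to `♭_γ`, the metric `γ` is the restriction of `G` to covectors, from which it inherits
symmetry and positivity. -/
theorem gamma_eq_form (X Y : V) : G.gamma X Y = G.form (0, G.flatGamma Y) (0, G.flatGamma X) := by
  rw [← two_neutral_sharp, neutral_apply, sharp_fst]
  simp [gamma_apply]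

theorem gamma_symm (X Y : V) : G.gamma X Y = G.gamma Y X := by
  rw [gamma_eq_form, gamma_eq_form, G.symm]

theorem gamma_pos {X : V} (hX : X ≠ 0) : 0 < G.gamma X X := by
  rw [gamma_eq_form]
  exact G.pos _ (by simpa using hX)

@[simp]
theorem tauInv_fst (ε : ℝ) (X : V) : (G.tauInv ε X).1 = X := rfl

theorem tauInv_inj {ε : ℝ} {X Y : V} : G.tauInv ε X = G.tauInv ε Y ↔ X = Y :=
  ⟨fun h => congrArg Prod.fst h, fun h => by rw [h]⟩

theorem tauInv_snd (ε : ℝ) (X : V) :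
    (G.tauInv ε X).2 = -G.flatGamma (G.phi X) + ε • G.flatGamma X := rfl

theorem tauInv_snd_apply (ε : ℝ) (X Y : V) :
    (G.tauInv ε X).2 Y = G.psi X Y + ε * G.gamma X Y := rfl

variable {ε : ℝ}

/-- The image of `τ_±⁻¹` consists of eigenvectors of `♯_G`. -/
theorem sharp_tauInv (hε : ε = 1 ∨ ε = -1) (X : V) :
    G.sharp (G.tauInv ε X) = ε • G.tauInv ε X := by
  have hεε : ε * ε = 1 := by rcases hε with rfl | rfl <;> norm_num
  have h1 : (G.sharp (G.tauInv ε X)).1 = ε • X := by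
    rw [sharp_fst, tauInv_snd]
    simp
  -- The vector part is already correct. The error `w` is an eigenvector for `-ε` with zero vector
  -- part, so `♯_γ` kills its covector part, and `♯_γ` is injective. Thus the second row of the
  -- matrix of `♯_G` is never needed.
  set w := G.sharp (G.tauInv ε X) - ε • G.tauInv ε X with hw
  have hw1 : w.1 = 0 := by simp [hw, h1]
  have hw2 : G.sharp w = -(ε • w) := by
    rw [hw, map_sub, map_smul, sharp_involutive, smul_sub, smul_smul, hεε, one_smul,
      neg_sub]
  have h3 := G.sharp_fst w
  rw [hw2, Prod.fst_neg, Prod.smul_fst, hw1, smul_zero, neg_zero, map_zero, zero_add] at h3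
  have h4 : w.2 = 0 := G.sharpGamma_injective (by rw [← h3, map_zero])
  exact sub_eq_zero.1 (Prod.ext hw1 h4)

/-- The vector part of the eigenvalue equation, `φ X + ♯_γ α = ε X`, already determines `α` from
`X`; hence each eigenspace is a graph. -/
theorem sharp_eq_smul_iff (hε : ε = 1 ∨ ε = -1) (u : V × (V →L[ℝ] ℝ)) :
    G.sharp u = ε • u ↔ u = G.tauInv ε u.1 := by
  constructor
  · intro h
    have h1 := G.sharp_fst u
    rw [h, Prod.smul_fst] at h1
    refine Prod.ext rfl ?_
    apply G.sharpGamma_injective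
    rw [tauInv_snd, map_add, map_neg, map_smul, sharpGamma_flatGamma, sharpGamma_flatGamma, h1]
    abel
  · intro h
    rw [h]
    exact G.sharp_tauInv hε _

/-- `V_+` and `V_-` are `g`-orthogonal because `♯_G` is self-adjoint; the `γ`-terms in this
orthogonality cancel by symmetry. -/
theorem psi_antisymm (X Y : V) : G.psi X Y = -G.psi Y X := by
  have h := G.neutral_sharp_left (G.tauInv 1 X) (G.tauInv (-1) Y)
  rw [G.sharp_tauInv (Or.inl rfl), G.sharp_tauInv (Or.inr rfl)] at h
  simp only [map_smul, LinearMap.smul_apply, neutral_apply, tauInv_fst, tauInv_snd_apply,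
    smul_eq_mul] at h
  linarith [G.gamma_symm X Y]

/-- Through this identity the `g`-skewness of `Φ` becomes the `γ`-skewness of `F_±`. -/
theorem neutral_tauInv (X Y : V) : neutral (G.tauInv ε X) (G.tauInv ε Y) = ε * G.gamma X Y := by
  rw [neutral_apply, tauInv_snd_apply, tauInv_snd_apply, tauInv_fst, tauInv_fst,
    G.psi_antisymm X Y, G.gamma_symm Y X]
  ring

section FStructure

variable {G} {Φ : Module.End ℝ (V × (V →L[ℝ] ℝ))}

/-- An endomorphism that is skew-symmetric for `g` and for `G` commutes with `♯_G`. -/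
theorem sharp_comm (hg : ∀ u v, neutral (Φ u) v + neutral u (Φ v) = 0)
    (hG : ∀ u v, G.form (Φ u) v + G.form u (Φ v) = 0) (u : V × (V →L[ℝ] ℝ)) :
    G.sharp (Φ u) = Φ (G.sharp u) := by
  refine eq_of_forall_neutral_eq fun v => ?_
  have h1 := hG u v
  rw [← two_neutral_sharp, ← two_neutral_sharp] at h1
  have h2 := hg (G.sharp u) v
  linarith

/-- `Φ` preserves `V_±`, where it is given by `F_±`. -/
theorem map_tauInv (hε : ε = 1 ∨ ε = -1) (hg : ∀ u v, neutral (Φ u) v + neutral u (Φ v) = 0)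
    (hG : ∀ u v, G.form (Φ u) v + G.form u (Φ v) = 0) (X : V) :
    Φ (G.tauInv ε X) = G.tauInv ε (G.fPart Φ ε X) :=
  (G.sharp_eq_smul_iff hε _).1 (by rw [sharp_comm hg hG, G.sharp_tauInv hε, map_smul])

theorem fPart_cube (hε : ε = 1 ∨ ε = -1) (hg : ∀ u v, neutral (Φ u) v + neutral u (Φ v) = 0)
    (hG : ∀ u v, G.form (Φ u) v + G.form u (Φ v) = 0) (hΦ : ∀ u, Φ (Φ (Φ u)) + Φ u = 0) (X : V) :
    G.fPart Φ ε (G.fPart Φ ε (G.fPart Φ ε X)) + G.fPart Φ ε X = 0 := by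
  have h := congrArg Prod.fst (hΦ (G.tauInv ε X))
  rw [map_tauInv hε hg hG, map_tauInv hε hg hG, map_tauInv hε hg hG] at h
  exact h

theorem fPart_skew (hε : ε = 1 ∨ ε = -1) (hg : ∀ u v, neutral (Φ u) v + neutral u (Φ v) = 0)
    (hG : ∀ u v, G.form (Φ u) v + G.form u (Φ v) = 0) (X Y : V) :
    G.gamma X (G.fPart Φ ε Y) + G.gamma (G.fPart Φ ε X) Y = 0 := by
  have h := hg (G.tauInv ε X) (G.tauInv ε Y)
  rw [map_tauInv hε hg hG, map_tauInv hε hg hG, neutral_tauInv, neutral_tauInv] at h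
  rcases hε with rfl | rfl <;> linarith

end FStructure

end GenEuclideanMetric

end EuclideanFibre

/-! ### The tensor fields of a generalized metric structure acting on sections -/

section Operators

set_option linter.unusedSectionVars false

variable {E : Type*} [NormedAddCommGroup E] [NormedSpace ℝ E] [FiniteDimensional ℝ E]
  {M : Type*} [TopologicalSpace M] [T2Space M] [ChartedSpace E M] [IsManifold 𝓘(ℝ, E) ∞ M]

theorem exists_vecField_apply_eq (x : M) (v : TangentSpace 𝓘(ℝ, E) x) :
    ∃ X : VecField E M, X x = v :=
  exists_section_apply_eq (E := E) E (TangentSpace 𝓘(ℝ, E) : M → Type _) x v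

namespace GenRiemannianMetric

variable (G : GenRiemannianMetric E M)

/-- The endomorphism `♯_G` on sections. -/
def sharpSec (s : BigSection E M) : BigSection E M :=
  (⟨fun x => ((G.toFun x).sharp (s.val x)).1, contMDiff_vecField_of_forall_oneForm fun β => by
      -- `G(s, (0, β)) = 2 g(♯_G s, (0, β))` is `β` applied to the vector part of `♯_G s`.
      refine (G.smooth s (0, β)).congr fun x => ?_
      rw [← GenEuclideanMetric.two_neutral_sharp, neutral_apply]
      simp [BigSection.val]⟩,
    ⟨fun x => ((G.toFun x).sharp (s.val x)).2, contMDiff_oneForm_of_forall_vecField fun Y => by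
      refine (G.smooth s (Y, 0)).congr fun x => ?_
      rw [← GenEuclideanMetric.two_neutral_sharp, neutral_apply]
      simp [BigSection.val]⟩)

/-- The endomorphism `φ` on vector fields. -/
def phiField (X : VecField E M) : VecField E M := (G.sharpSec (X, 0)).1

/-- The isomorphism `♭_γ` from vector fields to `1`-forms. -/
def flatField (X : VecField E M) : OneForm E M :=
  ⟨fun x => (G.toFun x).flatGamma (X x), contMDiff_symm_vecField (fun x => (G.toFun x).flatGamma)
    (fun β => ⟨(G.sharpSec (0, β)).1, fun _ => rfl⟩) X⟩

theorem contMDiff_gamma (X Y : VecField E M) :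
    ContMDiff 𝓘(ℝ, E) 𝓘(ℝ) ∞ (fun x => G.gamma x (X x) (Y x)) :=
  contMDiff_oneForm_apply (G.flatField X) Y

theorem contMDiff_psi (X Y : VecField E M) :
    ContMDiff 𝓘(ℝ, E) 𝓘(ℝ) ∞ (fun x => G.psi x (X x) (Y x)) :=
  (contMDiff_oneForm_apply (G.flatField (G.phiField X)) Y).neg

theorem mdifferentiableAt_gamma (X Y : VecField E M) (x : M) :
    MDifferentiableAt 𝓘(ℝ, E) 𝓘(ℝ) (fun x => G.gamma x (X x) (Y x)) x :=
  (G.contMDiff_gamma X Y).mdifferentiable (by simp) x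

theorem mdifferentiableAt_psi (X Y : VecField E M) (x : M) :
    MDifferentiableAt 𝓘(ℝ, E) 𝓘(ℝ) (fun x => G.psi x (X x) (Y x)) x :=
  (G.contMDiff_psi X Y).mdifferentiable (by simp) x

theorem gamma_symm (x : M) (u v : TangentSpace 𝓘(ℝ, E) x) : G.gamma x u v = G.gamma x v u :=
  (G.toFun x).gamma_symm u v

theorem psi_antisymm (x : M) (u v : TangentSpace 𝓘(ℝ, E) x) : G.psi x u v = -G.psi x v u :=
  (G.toFun x).psi_antisymm u v

theorem isRiemannianMetric_gamma : IsRiemannianMetric G.gamma where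
  symm := G.gamma_symm
  pos x _ hu := (G.toFun x).gamma_pos hu
  smooth := G.contMDiff_gamma

/-- The section `τ_±⁻¹ X = (X, i(X)(ψ ± γ))` of `V_±`. -/
def tauSec (ε : ℝ) (X : VecField E M) : BigSection E M :=
  (X, -G.flatField (G.phiField X) + ε • G.flatField X)

theorem tauSec_fst (ε : ℝ) (X : VecField E M) : (G.tauSec ε X).1 = X := rfl

theorem tauSec_val (ε : ℝ) (X : VecField E M) (x : M) :
    (G.tauSec ε X).val x = (G.toFun x).tauInv ε (X x) := rfl

theorem tauSec_snd_apply (ε : ℝ) (X : VecField E M) (x : M) (v : TangentSpace 𝓘(ℝ, E) x) :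
    (G.tauSec ε X).2 x v = G.psi x (X x) v + ε * G.gamma x (X x) v := rfl

theorem eq_tauSec_of_val {ε : ℝ} {s : BigSection E M}
    (h : ∀ x, s.val x = (G.toFun x).tauInv ε (s.val x).1) : s = G.tauSec ε s.1 := by
  refine Prod.ext rfl (ContMDiffSection.ext fun x => ?_)
  exact congrArg Prod.snd (h x)

end GenRiemannianMetric

variable (Φ : GenFStructure E M) (G : GenRiemannianMetric E M)

/-- The endomorphisms `F_±` on vector fields. -/
def fField (ε : ℝ) : VecField E M →+ VecField E M where
  -- The values of the chosen section are forced pointwise by `Φ`, so the choice does not affect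
  -- additivity.
  toFun X := (Φ.smooth (G.tauSec ε X)).choose.1
  map_zero' := by
    ext x
    have := congrArg Prod.fst ((Φ.smooth (G.tauSec ε 0)).choose_spec x)
    exact this.trans (by simp [GenRiemannianMetric.tauSec_val])
  map_add' X Y := by
    ext x
    have h1 := congrArg Prod.fst ((Φ.smooth (G.tauSec ε (X + Y))).choose_spec x)
    have h2 := congrArg Prod.fst ((Φ.smooth (G.tauSec ε X)).choose_spec x)
    have h3 := congrArg Prod.fst ((Φ.smooth (G.tauSec ε Y)).choose_spec x)
    rw [GenRiemannianMetric.tauSec_val] at h1 h2 h3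
    simp only [ContMDiffSection.coe_add, Pi.add_apply, map_add, Prod.fst_add] at h1 ⊢
    exact h1.trans (congrArg₂ (· + ·) h2.symm h3.symm)

theorem fField_apply (ε : ℝ) (X : VecField E M) (x : M) :
    fField Φ G ε X x = G.fPart Φ ε x (X x) :=
  congrArg Prod.fst ((Φ.smooth (G.tauSec ε X)).choose_spec x)

theorem coe_fField (ε : ℝ) (X : VecField E M) :
    applyField (G.fPart Φ ε) X = fField Φ G ε X :=
  funext fun x => (fField_apply Φ G ε X x).symm

variable {Φ G} {ε : ℝ} (hε : ε = 1 ∨ ε = -1) (hΦG : IsGenMetricF Φ G)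
include hε hΦG

theorem fPart_cube (x : M) (u : TangentSpace 𝓘(ℝ, E) x) :
    G.fPart Φ ε x (G.fPart Φ ε x (G.fPart Φ ε x u)) + G.fPart Φ ε x u = 0 :=
  GenEuclideanMetric.fPart_cube hε (Φ.skew x) (hΦG x) (Φ.cube x) u

theorem fPart_skew (x : M) (u v : TangentSpace 𝓘(ℝ, E) x) :
    G.gamma x u (G.fPart Φ ε x v) + G.gamma x (G.fPart Φ ε x u) v = 0 :=
  GenEuclideanMetric.fPart_skew hε (Φ.skew x) (hΦG x) u v

theorem fField_cube (X : VecField E M) :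
    fField Φ G ε (fField Φ G ε (fField Φ G ε X)) = -fField Φ G ε X := by
  ext x
  rw [ContMDiffSection.coe_neg, Pi.neg_apply, fField_apply, fField_apply, fField_apply]
  exact eq_neg_of_add_eq_zero_left (fPart_cube hε hΦG x (X x))

theorem isClassicalF_fPart : IsClassicalF (G.fPart Φ ε) where
  smooth X := ⟨fField Φ G ε X, fField_apply Φ G ε X⟩
  cube := fPart_cube hε hΦG

end Operators

/-! ### The Courant bracket on `V_±` -/

section CourantBracket

set_option linter.unusedSectionVars false

variable {E : Type*} [NormedAddCommGroup E] [NormedSpace ℝ E] [FiniteDimensional ℝ E]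
  {M : Type*} [TopologicalSpace M] [T2Space M] [ChartedSpace E M] [IsManifold 𝓘(ℝ, E) ∞ M]

/-- The value on `Z` of the difference between the Courant bracket of `τ_±⁻¹ X` and `τ_±⁻¹ Y` and
the section `τ_±⁻¹ [X, Y]`. -/
def courantDefect (G : GenRiemannianMetric E M)
    (cov : CovariantDerivative 𝓘(ℝ, E) E (TangentSpace 𝓘(ℝ, E) : M → Type _)) (ε : ℝ)
    (X Y Z : VecField E M) (x : M) : ℝ :=
  extDeriv₂ G.psi X Y Z x
    - ε * (G.gamma x (X x) (cov Y x (Z x)) - G.gamma x (Y x) (cov X x (Z x)))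

variable (G : GenRiemannianMetric E M)
  (cov : CovariantDerivative 𝓘(ℝ, E) E (TangentSpace 𝓘(ℝ, E) : M → Type _)) (ε : ℝ)

omit [FiniteDimensional ℝ E] [T2Space M] [IsManifold 𝓘(ℝ, E) ∞ M] in
theorem mvfderiv_const_mul_apply (c : ℝ) {f : M → ℝ} {x : M}
    (hf : MDifferentiableAt 𝓘(ℝ, E) 𝓘(ℝ) f x) (v : TangentSpace 𝓘(ℝ, E) x) :
    mvfderiv 𝓘(ℝ, E) (fun y => c * f y) x v = c * mvfderiv 𝓘(ℝ, E) f x v := by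
  have h : mvfderiv 𝓘(ℝ, E) (fun _ : M => c) x = 0 := mvfderiv_const c
  rw [mvfderiv_fun_mul mdifferentiableAt_const hf, h]
  simp

theorem mvfderiv_psi_swap (X Y : VecField E M) (x : M) (v : TangentSpace 𝓘(ℝ, E) x) :
    mvfderiv 𝓘(ℝ, E) (fun y => G.psi y (X y) (Y y)) x v =
      -mvfderiv 𝓘(ℝ, E) (fun y => G.psi y (Y y) (X y)) x v := by
  have h : (fun y => G.psi y (X y) (Y y)) = -fun y => G.psi y (Y y) (X y) :=
    funext fun y => G.psi_antisymm y _ _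
  rw [h, mvfderiv_neg]
  rfl

theorem mvfderiv_psi_add_left (X X' Y : VecField E M) (x : M) (v : TangentSpace 𝓘(ℝ, E) x) :
    mvfderiv 𝓘(ℝ, E) (fun y => G.psi y ((X + X') y) (Y y)) x v =
      mvfderiv 𝓘(ℝ, E) (fun y => G.psi y (X y) (Y y)) x v +
        mvfderiv 𝓘(ℝ, E) (fun y => G.psi y (X' y) (Y y)) x v := by
  have h : (fun y => G.psi y ((X + X') y) (Y y)) =
      (fun y => G.psi y (X y) (Y y)) + fun y => G.psi y (X' y) (Y y) := by
    funext y
    simp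
  rw [h, mvfderiv_add (G.mdifferentiableAt_psi X Y x) (G.mdifferentiableAt_psi X' Y x)]
  rfl

theorem mvfderiv_psi_add_right (X Y Y' : VecField E M) (x : M) (v : TangentSpace 𝓘(ℝ, E) x) :
    mvfderiv 𝓘(ℝ, E) (fun y => G.psi y (X y) ((Y + Y') y)) x v =
      mvfderiv 𝓘(ℝ, E) (fun y => G.psi y (X y) (Y y)) x v +
        mvfderiv 𝓘(ℝ, E) (fun y => G.psi y (X y) (Y' y)) x v := by
  rw [mvfderiv_psi_swap, mvfderiv_psi_add_left, mvfderiv_psi_swap G X Y, mvfderiv_psi_swap G X Y']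
  ring

/-- Skewness reduces biadditivity of the defect to additivity in its second argument. -/
theorem courantDefect_swap (X Y Z : VecField E M) (x : M) :
    courantDefect G cov ε X Y Z x = -courantDefect G cov ε Y X Z x := by
  unfold courantDefect extDeriv₂
  rw [mvfderiv_psi_swap G Y Z, mvfderiv_psi_swap G Z X, mvfderiv_psi_swap G X Y,
    mlieBracket_swap_apply (V := X) (W := Y), mlieBracket_swap_apply (V := Y) (W := Z),
    mlieBracket_swap_apply (V := Z) (W := X)]
  simp only [map_neg, LinearMap.neg_apply]
  ring

theorem courantDefect_add_right (X Y Y' Z : VecField E M) (x : M) :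
    courantDefect G cov ε X (Y + Y') Z x =
      courantDefect G cov ε X Y Z x + courantDefect G cov ε X Y' Z x := by
  have : CompleteSpace E := FiniteDimensional.complete ℝ E
  unfold courantDefect extDeriv₂
  have h1 : cov ⇑(Y + Y') x = cov Y x + cov Y' x := by
    rw [ContMDiffSection.coe_add]
    exact cov.isCovariantDerivativeOnUniv.add Y.mdifferentiableAt Y'.mdifferentiableAt
  have h2 : mlieBracket 𝓘(ℝ, E) X ⇑(Y + Y') x =
      mlieBracket 𝓘(ℝ, E) X Y x + mlieBracket 𝓘(ℝ, E) X Y' x := by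
    rw [ContMDiffSection.coe_add]
    exact mlieBracket_add_right Y.mdifferentiableAt Y'.mdifferentiableAt
  have h3 : mlieBracket 𝓘(ℝ, E) ⇑(Y + Y') Z x =
      mlieBracket 𝓘(ℝ, E) Y Z x + mlieBracket 𝓘(ℝ, E) Y' Z x := by
    rw [ContMDiffSection.coe_add]
    exact mlieBracket_add_left Y.mdifferentiableAt Y'.mdifferentiableAt
  rw [mvfderiv_psi_add_left, mvfderiv_psi_add_right, h1, h2, h3]
  simp only [ContMDiffSection.coe_add, Pi.add_apply, map_add, LinearMap.add_apply,
    add_apply]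
  ring

theorem courantDefect_add_left (X X' Y Z : VecField E M) (x : M) :
    courantDefect G cov ε (X + X') Y Z x =
      courantDefect G cov ε X Y Z x + courantDefect G cov ε X' Y Z x := by
  rw [courantDefect_swap, courantDefect_add_right, courantDefect_swap G cov ε X,
    courantDefect_swap G cov ε X']
  ring

/-- The function `courantDefect` as a biadditive map in the first two arguments. -/
def courantDefectHom (Z : VecField E M) (x : M) : VecField E M →+ VecField E M →+ ℝ :=
  AddMonoidHom.mk' (fun X => AddMonoidHom.mk' (fun Y => courantDefect G cov ε X Y Z x)
    fun Y Y' => courantDefect_add_right G cov ε X Y Y' Z x)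
    fun X X' => AddMonoidHom.ext fun Y => courantDefect_add_left G cov ε X X' Y Z x

theorem courantDefectHom_apply (X Y Z : VecField E M) (x : M) :
    courantDefectHom G cov ε Z x X Y = courantDefect G cov ε X Y Z x := rfl

theorem lieDeriv_apply (X Z : VecField E M) (β : OneForm E M) (x : M) :
    lieDeriv X β x (Z x) =
      mvfderiv 𝓘(ℝ, E) (fun y => β y (Z y)) x (X x) - β x (mlieBracket 𝓘(ℝ, E) X Z x) :=
  TensorialAt.mkHom_apply (lieDerivAux_tensorial X β x) Z.mdifferentiableAt

theorem mvfderiv_tauSec_snd (X Y : VecField E M) (x : M) (v : TangentSpace 𝓘(ℝ, E) x) :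
    mvfderiv 𝓘(ℝ, E) (fun y => (G.tauSec ε X).2 y (Y y)) x v =
      mvfderiv 𝓘(ℝ, E) (fun y => G.psi y (X y) (Y y)) x v
        + ε * mvfderiv 𝓘(ℝ, E) (fun y => G.gamma y (X y) (Y y)) x v := by
  have h : (fun y => (G.tauSec ε X).2 y (Y y)) =
      (fun y => G.psi y (X y) (Y y)) + fun y => ε * G.gamma y (X y) (Y y) := rfl
  have hm : MDifferentiableAt 𝓘(ℝ, E) 𝓘(ℝ) (fun y => ε * G.gamma y (X y) (Y y)) x :=
    mdifferentiableAt_const.mul (G.mdifferentiableAt_gamma X Y x)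
  rw [h, mvfderiv_add (G.mdifferentiableAt_psi X Y x) hm,
    ← mvfderiv_const_mul_apply ε (G.mdifferentiableAt_gamma X Y x)]
  rfl

variable {cov}

/-- The Courant bracket of two sections of `V_±`. -/
theorem courant_tauSec_snd_apply (hcov : IsLeviCivita G.gamma cov) (X Y Z : VecField E M) (x : M) :
    (courant (G.tauSec ε X) (G.tauSec ε Y) x).2 (Z x) =
      ((G.toFun x).tauInv ε (mlieBracket 𝓘(ℝ, E) X Y x)).2 (Z x)
        + courantDefect G cov ε X Y Z x := by
  -- The symmetric `γ`-parts cancel and the `ψ`-parts double, which absorbs the factor `1/2` of the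
  -- Courant bracket.
  have h1 : (fun y => (G.tauSec ε X).2 y (Y y) - (G.tauSec ε Y).2 y (X y)) =
      fun y => 2 * G.psi y (X y) (Y y) := by
    funext y
    simp only [G.tauSec_snd_apply]
    rw [G.psi_antisymm y (Y y), G.gamma_symm y (Y y)]
    ring
  have h2 : (courant (G.tauSec ε X) (G.tauSec ε Y) x).2 (Z x) =
      lieDeriv X (G.tauSec ε Y).2 x (Z x) - lieDeriv Y (G.tauSec ε X).2 x (Z x)
        + (1 / 2 : ℝ) * mvfderiv 𝓘(ℝ, E)
          (fun y => (G.tauSec ε X).2 y (Y y) - (G.tauSec ε Y).2 y (X y)) x (Z x) := rfl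
  have h3 : ((G.toFun x).tauInv ε (mlieBracket 𝓘(ℝ, E) X Y x)).2 (Z x) =
      G.psi x (mlieBracket 𝓘(ℝ, E) X Y x) (Z x)
        + ε * G.gamma x (mlieBracket 𝓘(ℝ, E) X Y x) (Z x) := rfl
  rw [h2, h1, h3, lieDeriv_apply, lieDeriv_apply, mvfderiv_tauSec_snd, mvfderiv_tauSec_snd,
    mvfderiv_const_mul_apply 2 (G.mdifferentiableAt_psi X Y x),
    G.tauSec_snd_apply, G.tauSec_snd_apply, hcov.metric, hcov.metric]
  unfold courantDefect extDeriv₂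
  rw [mvfderiv_psi_swap G Z X, mlieBracket_swap_apply (V := Z) (W := X),
    G.psi_antisymm x (Y x) (mlieBracket 𝓘(ℝ, E) X Z x),
    G.psi_antisymm x (X x) (mlieBracket 𝓘(ℝ, E) Y Z x),
    ← hcov.torsion_free X Y, ← hcov.torsion_free X Z, ← hcov.torsion_free Y Z]
  simp only [map_neg, map_sub, LinearMap.sub_apply, LinearMap.neg_apply]
  simp
  rw [G.gamma_symm x (cov X x (Y x)) (Z x), G.gamma_symm x (cov Y x (X x)) (Z x)]
  ring

theorem courant_fst (s t : BigSection E M) (x : M) :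
    (courant s t x).1 = mlieBracket 𝓘(ℝ, E) s.1 t.1 x := rfl

/-- The formula of the structure theorem, in terms of the defect of the Courant bracket. -/
theorem courantDefect_fField (Φ : GenFStructure E M) (hε : ε = 1 ∨ ε = -1)
    (hΦG : IsGenMetricF Φ G) (hcov : IsLeviCivita G.gamma cov) (X Y Z : VecField E M) (x : M) :
    courantDefect G cov ε (fField Φ G ε X) (fField Φ G ε Y) Z x
      + courantDefect G cov ε (fField Φ G ε (fField Φ G ε X)) Y Z x =
    -2 * ε * (G.gamma x (G.fPart Φ ε x (X x)) (covEnd cov (G.fPart Φ ε) Z Y x) -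
      ε * (1 / 2) *
        (extDeriv₂ G.psi (applyField (G.fPart Φ ε) (applyField (G.fPart Φ ε) X)) Y Z x +
          extDeriv₂ G.psi (applyField (G.fPart Φ ε) X) (applyField (G.fPart Φ ε) Y) Z x)) := by
  have hεε : ε * ε = 1 := by rcases hε with rfl | rfl <;> norm_num
  unfold courantDefect covEnd
  rw [coe_fField, coe_fField, coe_fField]
  set FX := fField Φ G ε X
  set FY := fField Φ G ε Y
  have hskew : ∀ y, G.gamma y (FX y) (FY y) + G.gamma y (Y y) (fField Φ G ε FX y) = 0 := by
    intro y
    rw [fField_apply Φ G ε Y, fField_apply Φ G ε FX, G.gamma_symm y (Y y)]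
    exact fPart_skew hε hΦG y (FX y) (Y y)
  -- The derivative along `Z` of `γ(FX, FY) + γ(Y, F²X) = 0`. It trades the terms with `∇_Z(FX)` and
  -- `∇_Z(F²X)` for those with `∇_Z(FY)` and `∇_Z Y`, producing the factor `2` in front of `γ(FX,
  -- (∇_Z F)Y)`.
  have hd : mvfderiv 𝓘(ℝ, E) (fun y => G.gamma y (FX y) (FY y)) x (Z x) +
      mvfderiv 𝓘(ℝ, E) (fun y => G.gamma y (Y y) (fField Φ G ε FX y)) x (Z x) = 0 := by
    have h := congrArg (fun f => mvfderiv 𝓘(ℝ, E) f x (Z x)) (funext hskew)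
    rw [mvfderiv_fun_add (G.mdifferentiableAt_gamma _ _ x) (G.mdifferentiableAt_gamma _ _ x)] at h
    have h0 : mvfderiv 𝓘(ℝ, E) (fun _ : M => (0 : ℝ)) x = 0 := mvfderiv_const 0
    rwa [h0] at h
  rw [hcov.metric, hcov.metric] at hd
  rw [map_sub, ← fField_apply Φ G ε X x]
  have hF : G.gamma x (FX x) (G.fPart Φ ε x (cov Y x (Z x))) =
      -G.gamma x (fField Φ G ε FX x) (cov Y x (Z x)) := by
    rw [fField_apply Φ G ε FX]
    exact eq_neg_of_add_eq_zero_left (fPart_skew hε hΦG x (FX x) (cov Y x (Z x)))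
  rw [hF]
  rw [G.gamma_symm x (cov FX x (Z x)) (FY x), G.gamma_symm x (cov Y x (Z x))] at hd
  linear_combination ε * hd - (extDeriv₂ G.psi (fField Φ G ε FX) Y Z x +
    extDeriv₂ G.psi FX FY Z x) * hεε

end CourantBracket

/-! ### Comparison of the integrability conditions -/

/-- For an additive `F` with `F³ = -F` and a biadditive `T`, extended to complex coefficients, the
vanishing of `T(FX, FY) + T(F²X, Y)` amounts to the vanishing of `T` on `H × H` and on `H × Q`,
where `H` and `Q` are the `√-1`- and `0`-eigenspaces of `F`. -/
theorem forall_add_eq_zero_iff_of_cube {V : Type*} [AddCommGroup V] (T : V →+ V →+ ℝ) (F : V →+ V)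
    (hF : ∀ X, F (F (F X)) = -F X) :
    (∀ X Y, T (F X) (F Y) + T (F (F X)) Y = 0) ↔
      (∀ X₁ X₂ Y₁ Y₂, (F X₁ = -X₂ ∧ F X₂ = X₁) → (F Y₁ = -Y₂ ∧ F Y₂ = Y₁) →
        T X₁ Y₁ - T X₂ Y₂ = 0 ∧ T X₁ Y₂ + T X₂ Y₁ = 0) ∧
      (∀ X₁ X₂ Y₁ Y₂, (F X₁ = -X₂ ∧ F X₂ = X₁) → (F Y₁ = 0 ∧ F Y₂ = 0) →
        T X₁ Y₁ - T X₂ Y₂ = 0 ∧ T X₁ Y₂ + T X₂ Y₁ = 0) := by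
  constructor
  · intro h
    refine ⟨fun X₁ X₂ Y₁ Y₂ ⟨hX₁, hX₂⟩ ⟨hY₁, hY₂⟩ => ?_,
      fun X₁ X₂ Y₁ Y₂ ⟨hX₁, hX₂⟩ ⟨hY₁, hY₂⟩ => ?_⟩
    -- On `H`, `F` is multiplication by `√-1`: the pairs `(X₂, Y₂)` and `(X₁, Y₂)` give the real and
    -- the imaginary part.
    · have h1 := h X₂ Y₂
      have h2 := h X₁ Y₂
      rw [hX₂, hY₂, hX₁] at h1
      rw [hX₁, hY₂, map_neg F, hX₂] at h2
      simp only [map_neg, AddMonoidHom.neg_apply] at h1 h2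
      exact ⟨by linarith, by linarith⟩
    -- When `F Y = 0` the first term drops out and `F²X = -X`, so even the real values of `T`
    -- vanish. For `X₂` the argument is applied to `-√-1 (X₁ + √-1 X₂)`.
    · have key : ∀ X X' Y, F X = -X' → F X' = X → F Y = 0 → T X Y = 0 := by
        intro X X' Y hX hX' hY
        have h1 := h X Y
        rw [hX, hY, map_neg F, hX'] at h1
        simpa using h1
      have key' : ∀ Y, F Y = 0 → T X₂ Y = 0 := fun Y hY =>
        key X₂ (-X₁) Y (by rw [hX₂, neg_neg]) (by rw [map_neg, hX₁, neg_neg]) hY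
      rw [key X₁ X₂ Y₁ hX₁ hX₂ hY₁, key X₁ X₂ Y₂ hX₁ hX₂ hY₂, key' Y₁ hY₁, key' Y₂ hY₂]
      simp
  · rintro ⟨hH, hQ⟩ X Y
    -- Only real parts are needed: `F²X + √-1 FX` is paired with `-F²Y - √-1 FY` in `H` and with `Y
    -- + F²Y` in `Q`, and the two identities add up to the claim.
    have hX : F (F (F X)) = -F X ∧ F (F X) = F (F X) := ⟨hF X, rfl⟩
    have h1 := (hH (F (F X)) (F X) (-F (F Y)) (-F Y) hX
      ⟨by rw [map_neg, hF], by rw [map_neg]⟩).1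
    have h2 := (hQ (F (F X)) (F X) (Y + F (F Y)) 0 hX
      ⟨by rw [map_add, hF, add_neg_cancel], map_zero F⟩).1
    simp only [map_neg, map_add, map_zero] at h1 h2
    linarith

/-! ### Courant closedness on `V_±` as Lie closedness plus vanishing defect -/

section Closedness

set_option linter.unusedSectionVars false

variable {E : Type*} [NormedAddCommGroup E] [NormedSpace ℝ E] [FiniteDimensional ℝ E]
  {M : Type*} [TopologicalSpace M] [T2Space M] [ChartedSpace E M] [IsManifold 𝓘(ℝ, E) ∞ M]
  {G : GenRiemannianMetric E M}
  {cov : CovariantDerivative 𝓘(ℝ, E) E (TangentSpace 𝓘(ℝ, E) : M → Type _)}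

theorem bigTangent_eq_tauInv_iff (ε : ℝ) (x : M) (u : BigTangent E x) :
    u = (G.toFun x).tauInv ε u.1 ↔
      ∀ Z : VecField E M, u.2 (Z x) - ((G.toFun x).tauInv ε u.1).2 (Z x) = 0 := by
  refine ⟨fun h Z => by rw [← h, sub_self],
    fun h => Prod.ext rfl (ContinuousLinearMap.ext fun v => ?_)⟩
  obtain ⟨Z, rfl⟩ := exists_vecField_apply_eq x v
  exact sub_eq_zero.1 (h Z)

/-- Closedness under the Courant bracket of fields of subspaces of the complexification of `V_±`
amounts to the closedness of their projections under the Lie bracket and to the vanishing of the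
defect. -/
theorem courantClosed_iff_lieClosed (hcov : IsLeviCivita G.gamma cov) (ε : ℝ)
    {A B C : ∀ x : M, Submodule ℂ (ℂ ⊗[ℝ] TangentSpace 𝓘(ℝ, E) x)}
    {A' B' C' : ∀ x : M, Submodule ℂ (ℂ ⊗[ℝ] BigTangent E x)}
    (hA : ∀ x (u v : BigTangent E x), cplx u v ∈ A' x ↔
      (u = (G.toFun x).tauInv ε u.1 ∧ v = (G.toFun x).tauInv ε v.1) ∧ cplx u.1 v.1 ∈ A x)
    (hB : ∀ x (u v : BigTangent E x), cplx u v ∈ B' x ↔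
      (u = (G.toFun x).tauInv ε u.1 ∧ v = (G.toFun x).tauInv ε v.1) ∧ cplx u.1 v.1 ∈ B x)
    (hC : ∀ x (u v : BigTangent E x), cplx u v ∈ C' x ↔
      (u = (G.toFun x).tauInv ε u.1 ∧ v = (G.toFun x).tauInv ε v.1) ∧ cplx u.1 v.1 ∈ C x) :
    CourantClosed A' B' C' ↔ LieClosed A B C ∧
      ∀ X₁ X₂ Y₁ Y₂ : VecField E M, (∀ x, cplx (X₁ x) (X₂ x) ∈ A x) →
        (∀ x, cplx (Y₁ x) (Y₂ x) ∈ B x) → ∀ (Z : VecField E M) (x : M),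
          courantDefect G cov ε X₁ Y₁ Z x - courantDefect G cov ε X₂ Y₂ Z x = 0 ∧
          courantDefect G cov ε X₁ Y₂ Z x + courantDefect G cov ε X₂ Y₁ Z x = 0 := by
  have key : ∀ (X₁ X₂ Y₁ Y₂ : VecField E M) (x : M),
      cplx (courant (G.tauSec ε X₁) (G.tauSec ε Y₁) x - courant (G.tauSec ε X₂) (G.tauSec ε Y₂) x)
        (courant (G.tauSec ε X₁) (G.tauSec ε Y₂) x + courant (G.tauSec ε X₂) (G.tauSec ε Y₁) x)
          ∈ C' x ↔
      (∀ Z : VecField E M,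
        courantDefect G cov ε X₁ Y₁ Z x - courantDefect G cov ε X₂ Y₂ Z x = 0 ∧
        courantDefect G cov ε X₁ Y₂ Z x + courantDefect G cov ε X₂ Y₁ Z x = 0) ∧
      cplx (mlieBracket 𝓘(ℝ, E) X₁ Y₁ x - mlieBracket 𝓘(ℝ, E) X₂ Y₂ x)
        (mlieBracket 𝓘(ℝ, E) X₁ Y₂ x + mlieBracket 𝓘(ℝ, E) X₂ Y₁ x) ∈ C x := by
    intro X₁ X₂ Y₁ Y₂ x
    rw [hC, bigTangent_eq_tauInv_iff, bigTangent_eq_tauInv_iff, ← forall_and]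
    refine and_congr (forall_congr' fun Z => and_congr ?_ ?_) Iff.rfl
    · simp only [Prod.fst_sub, Prod.snd_sub, courant_fst, map_sub, sub_apply,
        courant_tauSec_snd_apply G ε hcov]
      refine Eq.congr_left ?_
      simp only [G.tauSec_fst]
      ring
    · simp only [Prod.fst_add, Prod.snd_add, courant_fst, map_add, add_apply,
        courant_tauSec_snd_apply G ε hcov]
      refine Eq.congr_left ?_
      simp only [G.tauSec_fst]
      ring
  constructor
  · intro h
    have h' := fun (X₁ X₂ Y₁ Y₂ : VecField E M) (hX : ∀ x, cplx (X₁ x) (X₂ x) ∈ A x)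
        (hY : ∀ x, cplx (Y₁ x) (Y₂ x) ∈ B x) (x : M) =>
      (key X₁ X₂ Y₁ Y₂ x).1 (h (G.tauSec ε X₁) (G.tauSec ε X₂) (G.tauSec ε Y₁) (G.tauSec ε Y₂)
        (fun x => (hA x _ _).2 ⟨⟨rfl, rfl⟩, hX x⟩) (fun x => (hB x _ _).2 ⟨⟨rfl, rfl⟩, hY x⟩) x)
    exact ⟨fun X₁ X₂ Y₁ Y₂ hX hY x => (h' X₁ X₂ Y₁ Y₂ hX hY x).2,
      fun X₁ X₂ Y₁ Y₂ hX hY Z x => (h' X₁ X₂ Y₁ Y₂ hX hY x).1 Z⟩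
  · rintro ⟨hL, hT⟩ s₁ s₂ t₁ t₂ hs ht x
    have hs' := fun x => (hA x _ _).1 (hs x)
    have ht' := fun x => (hB x _ _).1 (ht x)
    -- Sections of `V_±` are the lifts of their vector parts, so testing on lifts loses nothing.
    rw [G.eq_tauSec_of_val fun x => (hs' x).1.1, G.eq_tauSec_of_val fun x => (hs' x).1.2,
      G.eq_tauSec_of_val fun x => (ht' x).1.1, G.eq_tauSec_of_val fun x => (ht' x).1.2]
    exact (key _ _ _ _ x).2 ⟨fun Z => hT _ _ _ _ (fun x => (hs' x).2) (fun x => (ht' x).2) Z x,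
      hL _ _ _ _ (fun x => (hs' x).2) (fun x => (ht' x).2) x⟩

variable {Φ : GenFStructure E M} {ε : ℝ}

/-- Pointwise eigenvector conditions become equations for the additive operator `fField`, the form
required by `forall_add_eq_zero_iff_of_cube`. -/
theorem forall_cplx_mem_eigen_I_iff (X₁ X₂ : VecField E M) :
    (∀ x, cplx (X₁ x) (X₂ x) ∈ eigen (G.fPart Φ ε x) Complex.I) ↔
      fField Φ G ε X₁ = -X₂ ∧ fField Φ G ε X₂ = X₁ := by
  simp only [cplx_mem_eigen_I, forall_and, ← fField_apply, ContMDiffSection.ext_iff,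
    ContMDiffSection.coe_neg, Pi.neg_apply]

theorem forall_cplx_mem_eigen_zero_iff (X₁ X₂ : VecField E M) :
    (∀ x, cplx (X₁ x) (X₂ x) ∈ eigen (G.fPart Φ ε x) 0) ↔
      fField Φ G ε X₁ = 0 ∧ fField Φ G ε X₂ = 0 := by
  simp only [cplx_mem_eigen_zero, forall_and, ← fField_apply, ContMDiffSection.ext_iff,
    ContMDiffSection.coe_zero, Pi.zero_apply]

section Membership

variable (hε : ε = 1 ∨ ε = -1) (hΦG : IsGenMetricF Φ G) (x : M) (u v : BigTangent E x)
include hε hΦG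

theorem map_tauInv (X : TangentSpace 𝓘(ℝ, E) x) :
    Φ.toFun x ((G.toFun x).tauInv ε X) = (G.toFun x).tauInv ε (G.fPart Φ ε x X) :=
  GenEuclideanMetric.map_tauInv hε (Φ.skew x) (hΦG x) X

/-- Since `Φ` acts on the graph `V_±` through `F_±`, and lifts are determined by their vector parts,
`E_±` is the lift of `H`. -/
theorem cplx_mem_eigenV_inf_eigenE :
    cplx u v ∈ G.eigenV ε x ⊓ Φ.eigenE x ↔
      (u = (G.toFun x).tauInv ε u.1 ∧ v = (G.toFun x).tauInv ε v.1) ∧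
        cplx u.1 v.1 ∈ eigen (G.fPart Φ ε x) Complex.I := by
  rw [Submodule.mem_inf, GenRiemannianMetric.eigenV, GenFStructure.eigenE, cplx_mem_eigen_ofReal,
    cplx_mem_eigen_I, cplx_mem_eigen_I, (G.toFun x).sharp_eq_smul_iff hε,
    (G.toFun x).sharp_eq_smul_iff hε]
  refine and_congr_right fun ⟨hu, hv⟩ => ?_
  rw [hu, hv, map_tauInv hε hΦG, map_tauInv hε hΦG, ← map_neg]
  exact and_congr (G.toFun x).tauInv_inj (G.toFun x).tauInv_inj

theorem cplx_mem_eigenV_inf_eigenS :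
    cplx u v ∈ G.eigenV ε x ⊓ Φ.eigenS x ↔
      (u = (G.toFun x).tauInv ε u.1 ∧ v = (G.toFun x).tauInv ε v.1) ∧
        cplx u.1 v.1 ∈ eigen (G.fPart Φ ε x) 0 := by
  rw [Submodule.mem_inf, GenRiemannianMetric.eigenV, GenFStructure.eigenS, cplx_mem_eigen_ofReal,
    cplx_mem_eigen_zero, cplx_mem_eigen_zero, (G.toFun x).sharp_eq_smul_iff hε,
    (G.toFun x).sharp_eq_smul_iff hε]
  refine and_congr_right fun ⟨hu, hv⟩ => ?_
  rw [hu, hv, map_tauInv hε hΦG, map_tauInv hε hΦG, ← map_zero ((G.toFun x).tauInv ε)]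
  exact and_congr (G.toFun x).tauInv_inj (G.toFun x).tauInv_inj

theorem cplx_mem_eigenV_inf_eigenE_sup_eigenV_inf_eigenS :
    cplx u v ∈ (G.eigenV ε x ⊓ Φ.eigenE x) ⊔ (G.eigenV ε x ⊓ Φ.eigenS x) ↔
      (u = (G.toFun x).tauInv ε u.1 ∧ v = (G.toFun x).tauInv ε v.1) ∧
        cplx u.1 v.1 ∈ eigen (G.fPart Φ ε x) Complex.I ⊔ eigen (G.fPart Φ ε x) 0 := by
  rw [GenRiemannianMetric.eigenV, GenFStructure.eigenE, GenFStructure.eigenS,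
    cplx_mem_inf_sup_inf_eigen _ _ (GenEuclideanMetric.sharp_comm (Φ.skew x) (hΦG x)) (Φ.cube x),
    cplx_mem_sup_eigen _ (fPart_cube hε hΦG x), (G.toFun x).sharp_eq_smul_iff hε,
    (G.toFun x).sharp_eq_smul_iff hε]
  refine and_congr_right fun ⟨hu, hv⟩ => ?_
  rw [hu, hv]
  simp only [map_tauInv hε hΦG, ← map_neg]
  exact and_congr (G.toFun x).tauInv_inj (G.toFun x).tauInv_inj

end Membership

/-- The two closedness conditions of a CRFK-structure on `V_±`, in terms of `F_±`. -/
theorem courantClosed_and_courantClosed_iff (hcov : IsLeviCivita G.gamma cov)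
    (hε : ε = 1 ∨ ε = -1) (hΦG : IsGenMetricF Φ G) :
    (CourantClosed (fun x => G.eigenV ε x ⊓ Φ.eigenE x) (fun x => G.eigenV ε x ⊓ Φ.eigenE x)
        (fun x => G.eigenV ε x ⊓ Φ.eigenE x) ∧
      CourantClosed (fun x => G.eigenV ε x ⊓ Φ.eigenE x) (fun x => G.eigenV ε x ⊓ Φ.eigenS x)
        (fun x => (G.eigenV ε x ⊓ Φ.eigenE x) ⊔ (G.eigenV ε x ⊓ Φ.eigenS x))) ↔
      IsClassicalMetricCRF (G.fPart Φ ε) G.gamma ∧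
      ∀ (X Y Z : VecField E M) (x : M),
        G.gamma x (G.fPart Φ ε x (X x)) (covEnd cov (G.fPart Φ ε) Z Y x) =
          ε * (1 / 2) *
            (extDeriv₂ G.psi (applyField (G.fPart Φ ε) (applyField (G.fPart Φ ε) X)) Y Z x +
              extDeriv₂ G.psi (applyField (G.fPart Φ ε) X) (applyField (G.fPart Φ ε) Y) Z x) := by
  have hclassical : IsClassicalMetricCRF (G.fPart Φ ε) G.gamma ↔
      LieClosed (fun x => eigen (G.fPart Φ ε x) Complex.I)
        (fun x => eigen (G.fPart Φ ε x) Complex.I) (fun x => eigen (G.fPart Φ ε x) Complex.I) ∧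
      LieClosed (fun x => eigen (G.fPart Φ ε x) Complex.I) (fun x => eigen (G.fPart Φ ε x) 0)
        (fun x => eigen (G.fPart Φ ε x) Complex.I ⊔ eigen (G.fPart Φ ε x) 0) :=
    ⟨fun h => ⟨h.closed_H_H, h.closed_H_Q⟩, fun h => ⟨isClassicalF_fPart hε hΦG,
      G.isRiemannianMetric_gamma, fPart_skew hε hΦG, h.1, h.2⟩⟩
  have hformula : (∀ (X Y Z : VecField E M) (x : M),
      G.gamma x (G.fPart Φ ε x (X x)) (covEnd cov (G.fPart Φ ε) Z Y x) =
        ε * (1 / 2) *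
          (extDeriv₂ G.psi (applyField (G.fPart Φ ε) (applyField (G.fPart Φ ε) X)) Y Z x +
            extDeriv₂ G.psi (applyField (G.fPart Φ ε) X) (applyField (G.fPart Φ ε) Y) Z x)) ↔
      ∀ (Z : VecField E M) (x : M) (X Y : VecField E M),
        courantDefectHom G cov ε Z x (fField Φ G ε X) (fField Φ G ε Y)
          + courantDefectHom G cov ε Z x (fField Φ G ε (fField Φ G ε X)) Y = 0 := by
    have hε0 : -2 * ε ≠ 0 := by rcases hε with rfl | rfl <;> norm_num
    simp only [courantDefectHom_apply, courantDefect_fField G ε Φ hε hΦG hcov,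
      mul_eq_zero_iff_left hε0, sub_eq_zero]
    exact ⟨fun h Z x X Y => h X Y Z x, fun h X Y Z x => h Z x X Y⟩
  rw [courantClosed_iff_lieClosed hcov ε (cplx_mem_eigenV_inf_eigenE hε hΦG)
      (cplx_mem_eigenV_inf_eigenE hε hΦG) (cplx_mem_eigenV_inf_eigenE hε hΦG),
    courantClosed_iff_lieClosed hcov ε (cplx_mem_eigenV_inf_eigenE hε hΦG)
      (cplx_mem_eigenV_inf_eigenS hε hΦG)
      (cplx_mem_eigenV_inf_eigenE_sup_eigenV_inf_eigenS hε hΦG), and_and_and_comm, hclassical,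
    hformula]
  -- The Lie conditions have been matched; what remains is the vanishing of the defect, compared
  -- separately for each `Z` and `x`.
  refine and_congr_right fun _ => ?_
  rw [forall₂_congr fun (Z : VecField E M) (x : M) => forall_add_eq_zero_iff_of_cube
    (courantDefectHom G cov ε Z x) (fField Φ G ε) (fField_cube hε hΦG)]
  simp only [forall_cplx_mem_eigen_I_iff,
    forall_cplx_mem_eigen_zero_iff, courantDefectHom_apply]
  exact ⟨fun h Z x => ⟨fun X₁ X₂ Y₁ Y₂ hX hY => h.1 X₁ X₂ Y₁ Y₂ hX hY Z x,
      fun X₁ X₂ Y₁ Y₂ hX hY => h.2 X₁ X₂ Y₁ Y₂ hX hY Z x⟩,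
    fun h => ⟨fun X₁ X₂ Y₁ Y₂ hX hY Z x => (h Z x).1 X₁ X₂ Y₁ Y₂ hX hY,
      fun X₁ X₂ Y₁ Y₂ hX hY Z x => (h Z x).2 X₁ X₂ Y₁ Y₂ hX hY⟩⟩

end Closedness

end GenCRF

end

theorem proposition4p5
    {E : Type*} [NormedAddCommGroup E] [NormedSpace ℝ E] [FiniteDimensional ℝ E]
    {M : Type*} [TopologicalSpace M] [T2Space M] [SigmaCompactSpace M]
    [ChartedSpace E M] [IsManifold 𝓘(ℝ, E) ∞ M]
    (Φ : GenCRF.GenFStructure E M) (G : GenCRF.GenRiemannianMetric E M)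
    (hΦG : GenCRF.IsGenMetricCRF Φ G)
    (cov : CovariantDerivative 𝓘(ℝ, E) E (TangentSpace 𝓘(ℝ, E) : M → Type _))
    (hcov : GenCRF.IsLeviCivita G.gamma cov) :
    GenCRF.IsCRFK Φ G ↔
      (∀ ε : ℝ, (ε = 1 ∨ ε = -1) →
        GenCRF.IsClassicalMetricCRF (G.fPart Φ ε) G.gamma) ∧
      (∀ ε : ℝ, (ε = 1 ∨ ε = -1) → ∀ (X Y Z : GenCRF.VecField E M) (x : M),
        G.gamma x (G.fPart Φ ε x (X x)) (GenCRF.covEnd cov (G.fPart Φ ε) Z Y x) =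
          ε * (1 / 2) *
            (GenCRF.extDeriv₂ G.psi
                (GenCRF.applyField (G.fPart Φ ε) (GenCRF.applyField (G.fPart Φ ε) X)) Y Z x +
              GenCRF.extDeriv₂ G.psi (GenCRF.applyField (G.fPart Φ ε) X)
                (GenCRF.applyField (G.fPart Φ ε) Y) Z x)) := by
  rw [GenCRF.IsCRFK, and_iff_right hΦG.1, ← forall₂_and]
  exact forall₂_congr fun ε hε => GenCRF.courantClosed_and_courantClosed_iff hcov hε hΦG.1
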